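/- Let $q$ be a prime power, $r$ an odd prime and $\epsilon\in\{1,-1\}$ with $\gcd(q-\epsilon,r)=1$. Let $G=\mathrm{PGL}_r^\epsilon(q)$, that is, $G=\mathrm{PGL}_r(q)$ if $\epsilon=1$ and $G=\mathrm{PGU}_r(q)$ if $\epsilon=-1$ (the image modulo scalars of $\mathrm{GU}_r(q)\le \mathrm{GL}_r(q^2)$). Put $a=\frac{q^r-\epsilon}{q-\epsilon}$, and let $H=\langle z\rangle{:}\langle\sigma\rangle\cong \mathbb{Z}_a{:}\mathbb{Z}_r$ (with $|z|=a$, $|\sigma|=r$, $\langle z\rangle$ normalised by $\sigma$ and $\langle z\rangle\cap\langle\sigma\rangle=1$) be a maximal subgroup of $G$. Let $G$ act transitively on a set $\Omega$ with point stabiliser $G_\alpha=H$, and put $N=|N_G(\langle\sigma\rangle)|$. The subdegrees of $G$ are the lengths of the orbits of $H$ on $\Omega$, and the multiplicity of $n$ is the number of these orbits of length $n$. Let $\mathrm{val}(G,H)$ be the valency of the Saxl graph of $G$, whose vertex set is $\Omega$ and in which two distinct points are adjacent if and only if their pointwise stabiliser in $G$ is trivial. Let $b(G)$ be the base size of $G$,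 the smallest size of a subset of $\Omega$ with trivial pointwise stabiliser. Then every subdegree of $G$ is one of $1$, $|H|$, $|H|/r$; the numbers $1$ and $|H|/r$ are always subdegrees, and if $b(G)=2$ then the set of subdegrees is exactly $\{1,|H|,|H|/r\}$. In all cases, the multiplicities of $1$, $|H|$ and $|H|/r$ are $$1,\qquad \frac{\mathrm{val}(G,H)}{|H|},\qquad \frac{N-r}{r}$$ respectively (so that $|H|$ has multiplicity $0$ if $\mathrm{val}(G,H)=0$), and $$\mathrm{val}(G,H)=|G:H|+a-1-\frac{aN}{r}.$$ -/

import Mathlib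

open scoped MatrixGroups

/-! ### Bases, Saxl graphs and suborbits -/

section Actions

variable (G : Type*) {Ω : Type*} [Group G] [MulAction G Ω]

/-- A set `B` of points is a base if its pointwise stabiliser in `G` is trivial. -/
def IsBase (B : Set Ω) : Prop :=
  fixingSubgroup G B = ⊥

variable (Ω) in
/-- The base size `b(G)`: the minimal size of a (finite) base. -/
noncomputable def baseSize : ℕ :=
  sInf {n : ℕ | ∃ B : Finset Ω, IsBase G (B : Set Ω) ∧ B.card = n}

variable (Ω) in
/-- The Saxl graph: vertex set `Ω`, two distinct points being adjacent iff they form a base. -/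
def saxlGraph : SimpleGraph Ω where
  Adj α β := α ≠ β ∧ IsBase G ({α, β} : Set Ω)
  symm := ⟨fun α β h => ⟨h.1.symm, by rw [Set.pair_comm]; exact h.2⟩⟩
  loopless := ⟨fun _ h => h.1 rfl⟩

/-- The valency of the vertex `α` in the Saxl graph (for a transitive action with point
stabiliser `H = G_α` this is `val(G, H)`). -/
noncomputable def saxlValency (α : Ω) : ℕ :=
  ((saxlGraph G Ω).neighborSet α).ncard

/-- The suborbits of `G` with respect to `α`: the orbits of the stabiliser `G_α` on `Ω`. -/
def suborbits (α : Ω) : Set (Set Ω) :=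
  Set.range fun β : Ω => MulAction.orbit (MulAction.stabilizer G α) β

/-- The subdegrees of `G` with respect to `α`: the lengths of the suborbits. -/
noncomputable def subdegrees (α : Ω) : Set ℕ :=
  Set.ncard '' suborbits G α

/-- The multiplicity of `n`: the number of suborbits of length `n`. -/
noncomputable def subdegreeMultiplicity (α : Ω) (n : ℕ) : ℕ :=
  {S ∈ suborbits G α | S.ncard = n}.ncard

end Actions

/-! ### The groups `PGL_r^ε(q)` -/

section Groups

variable (p k r : ℕ) (F : Type*) [Field F] [ExpChar F p]

/-- The unitary group `GU_r(q)`, `q = p ^ k`, as the subgroup of those `A` in `GL_r(F)` with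
`A * ((A^(q))ᵀ) = 1`, where `A^(q)` raises every entry to its `q`-th power. It is meant for a
field `F` with `q ^ 2` elements. -/
def generalUnitary : Subgroup (GL (Fin r) F) where
  carrier := {A | (A : Matrix (Fin r) (Fin r) F) *
    ((A : Matrix (Fin r) (Fin r) F).map (iterateFrobenius F p k)).transpose = 1}
  one_mem' := by simp
  mul_mem' := by
    intro A B hA hB
    simp only [Set.mem_ofPred_eq] at hA hB ⊢
    rw [Units.val_mul, Matrix.map_mul, Matrix.transpose_mul, Matrix.mul_assoc,
      ← Matrix.mul_assoc (B : Matrix (Fin r) (Fin r) F), hB, Matrix.one_mul, hA]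
  inv_mem' := by
    intro A hA
    simp only [Set.mem_ofPred_eq] at hA ⊢
    have h1 : ((A : Matrix (Fin r) (Fin r) F).map (iterateFrobenius F p k)).transpose
        = ((A⁻¹ : GL (Fin r) F) : Matrix (Fin r) (Fin r) F) := by
      rw [← Matrix.one_mul (Matrix.transpose _), ← Units.inv_mul A, Matrix.mul_assoc, hA,
        Matrix.mul_one]
    have h2 : ((A : Matrix (Fin r) (Fin r) F).map (iterateFrobenius F p k)).transpose *
        (((A⁻¹ : GL (Fin r) F) : Matrix (Fin r) (Fin r) F).map
          (iterateFrobenius F p k)).transpose = 1 := by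
      rw [← Matrix.transpose_mul, ← Matrix.map_mul, Units.inv_mul]
      simp
    rw [h1] at h2
    exact h2

/-- `GL_r^ε(q)`: the full general linear group for `ε = 1` (with `F` of order `q`), the unitary
group for `ε = -1` (with `F` of order `q ^ 2`), where `q = p ^ k`. -/
def GLEps (ε : ℤˣ) : Subgroup (GL (Fin r) F) :=
  if ε = 1 then ⊤ else generalUnitary p k r F

/-- `PGL_r^ε(q)`: the image of `GL_r^ε(q)` modulo scalars, so `PGL_r(q)` for `ε = 1` and
`PGU_r(q)` for `ε = -1`. -/
def PGLEps (ε : ℤˣ) : Subgroup (PGL(r, F)) :=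
  (GLEps p k r F ε).map Matrix.ProjGenLinGroup.mk

end Groups

/-! ### Self-centralising cyclic subgroups and the associated permutation groups -/

/-! The argument separates permutation group theory from matrix algebra, and `IsSingerPair` is the
interface between them.

Permutation side: `H` is a Frobenius group with kernel `⟨z⟩` and complement `⟨σ⟩`. If a nontrivial
`t ∈ ⟨z⟩` also fixes `g • α`, then `g⁻¹ * t * g` lies in `H` and has order dividing `a`, hence lies
in `⟨z⟩`. Self-centralisation then makes `g` normalise `⟨z⟩`, and the order bound makes that
normaliser equal to `H`, so `g • α = α`. A two-point stabiliser therefore misses the kernel and is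
trivial or `H`-conjugate to `⟨σ⟩`, giving orbits of length `|H|` or `a`. Each orbit of length `a`
contains exactly one fixed point of `σ`. The group `N_G(⟨σ⟩)` is transitive on all fixed points of
`σ`, with point stabiliser `⟨σ⟩`, so there are `N / r` of them, one being `α`. Counting `Ω` by orbit
length gives the valency.

Matrix side: for a prime `s` dividing `a`, the order of `|F|` modulo `s` is exactly `r`. An element
of order `s` thus lifts to a matrix `A` for which `F[A]` is a field of degree `r` and its own
centraliser (`irreducible_minpoly_of_pow_eq_one`, `exists_adjoinRoot_eq_of_commute`). Centralisers
in `PGL` become images of subgroups of the cyclic group `F[A]ˣ`, and the normaliser acts on `F[A]`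
by permuting at most `r` roots of the minimal polynomial.

That `|H| / r` really occurs amounts to `N > r`. Powers of a lift `S` of `σ` are linearly
independent, so an element of `F[S]` in the group with two nonzero coefficients centralises `σ` and
lies outside `⟨σ⟩`. Such elements are written down explicitly, except in `PGL_3(2)`, where a
fixed-point count modulo 3 is used. -/

/-- `z` generates a cyclic subgroup containing the centralisers of all its nontrivial elements,
whose normaliser has at most `|z| * r` elements, where `σ` normalises `⟨z⟩` and has prime order `r`
coprime to the order of `z`. -/
structure IsSingerPair {G : Type*} [Group G] (z σ : G) (r : ℕ) : Prop where
  prime : r.Prime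
  orderOf_right : orderOf σ = r
  one_lt : 1 < orderOf z
  coprime : (orderOf z).Coprime r
  conj_mem : σ * z * σ⁻¹ ∈ Subgroup.zpowers z
  mem_of_commute : ∀ y ∈ Subgroup.zpowers z, y ≠ 1 → ∀ g, Commute g y → g ∈ Subgroup.zpowers z
  card_normalizer_le :
    Nat.card (Subgroup.normalizer (Subgroup.zpowers z : Set G)) ≤ orderOf z * r

namespace IsSingerPair

open Subgroup MulAction

/-! ### Frobenius structure of `⟨z⟩⟨σ⟩` -/

section Group

variable {G : Type*} [Group G] {z σ : G} {r : ℕ}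

lemma eq_one_of_mem (h : IsSingerPair z σ r) {x : G} (hz : x ∈ zpowers z) (hσ : x ∈ zpowers σ) :
    x = 1 := by
  rw [← orderOf_eq_one_iff]
  exact Nat.eq_one_of_dvd_coprimes h.coprime (orderOf_dvd_of_mem_zpowers hz)
    (h.orderOf_right ▸ orderOf_dvd_of_mem_zpowers hσ)

lemma right_ne_one (h : IsSingerPair z σ r) : σ ≠ 1 := by
  intro h1
  have := h.orderOf_right
  rw [h1, orderOf_one] at this
  exact h.prime.one_lt.ne this

lemma zpowers_eq_of_mem (h : IsSingerPair z σ r) {s : G} (hs : s ∈ zpowers σ) (hs1 : s ≠ 1) :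
    zpowers s = zpowers σ := by
  have : Fact r.Prime := ⟨h.prime⟩
  refine le_antisymm (zpowers_le.2 hs) (zpowers_le.2 ?_)
  have hc : Nat.card (zpowers σ) = r := by rw [Nat.card_zpowers, h.orderOf_right]
  have := mem_zpowers_of_prime_card (g := (⟨s, hs⟩ : zpowers σ)) (g' := ⟨σ, mem_zpowers σ⟩) hc
    (by simpa [Subtype.ext_iff] using hs1)
  obtain ⟨n, hn⟩ := this
  exact ⟨n, by simpa [Subtype.ext_iff] using hn⟩

lemma _root_.conj_mem_zpowers {z g t : G} (hg : g * z * g⁻¹ ∈ zpowers z) (ht : t ∈ zpowers z) :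
    g * t * g⁻¹ ∈ zpowers z := by
  obtain ⟨n, rfl⟩ := ht
  simp only [← conj_zpow]
  exact zpow_mem hg n

variable [Finite G]

lemma _root_.mem_normalizer_zpowers_iff {z g : G} :
    g ∈ normalizer (zpowers z : Set G) ↔ g * z * g⁻¹ ∈ zpowers z :=
  ⟨fun hg => (hg z).1 (mem_zpowers z), fun hg => mem_normalizer_fintype
    fun _ hn => conj_mem_zpowers hg hn⟩

lemma sup_le_normalizer (h : IsSingerPair z σ r) :
    zpowers z ⊔ zpowers σ ≤ normalizer (zpowers z : Set G) :=
  sup_le le_normalizer (zpowers_le.2 (mem_normalizer_zpowers_iff.2 h.conj_mem))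

lemma conj_mem_of_mem (h : IsSingerPair z σ r) {g t : G} (hg : g ∈ zpowers z ⊔ zpowers σ)
    (ht : t ∈ zpowers z) : g * t * g⁻¹ ∈ zpowers z :=
  (h.sup_le_normalizer hg t).1 ht

lemma exists_mul (h : IsSingerPair z σ r) {g : G} (hg : g ∈ zpowers z ⊔ zpowers σ) :
    ∃ t ∈ zpowers z, ∃ s ∈ zpowers σ, t * s = g := by
  have h1 := coe_mul_of_right_le_normalizer_left (zpowers z) (zpowers σ)
    (le_sup_right.trans h.sup_le_normalizer)
  have : g ∈ ((zpowers z ⊔ zpowers σ : Subgroup G) : Set G) := hg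
  rw [h1] at this
  exact Set.mem_mul.1 this

lemma card_sup (h : IsSingerPair z σ r) :
    Nat.card (zpowers z ⊔ zpowers σ : Subgroup G) = orderOf z * r := by
  rw [← h.orderOf_right, ← Nat.card_zpowers, ← Nat.card_zpowers, ← Nat.card_prod]
  refine (Nat.card_congr (Equiv.ofBijective (fun x : zpowers z × zpowers σ =>
    (⟨x.1 * x.2, mul_mem (mem_sup_left x.1.2) (mem_sup_right x.2.2)⟩ :
      (zpowers z ⊔ zpowers σ : Subgroup G))) ⟨?_, ?_⟩)).symm
  · rintro ⟨⟨t, ht⟩, ⟨s, hs⟩⟩ ⟨⟨t', ht'⟩, ⟨s', hs'⟩⟩ e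
    simp only [Subtype.mk.injEq] at e
    have e1 : t'⁻¹ * t = s' * s⁻¹ := by
      rw [inv_mul_eq_iff_eq_mul, ← mul_assoc, ← e, mul_inv_cancel_right]
    have e2 := h.eq_one_of_mem (mul_mem (inv_mem ht') ht) (e1 ▸ mul_mem hs' (inv_mem hs))
    have e3 := e2
    rw [e1] at e3
    rw [inv_mul_eq_one] at e2
    rw [mul_inv_eq_one] at e3
    subst e2 e3
    rfl
  · rintro ⟨g, hg⟩
    obtain ⟨t, ht, s, hs, rfl⟩ := h.exists_mul hg
    exact ⟨⟨⟨t, ht⟩, ⟨s, hs⟩⟩, rfl⟩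

lemma mem_of_conj (h : IsSingerPair z σ r) {g : G} (hg : g * z * g⁻¹ ∈ zpowers z) :
    g ∈ zpowers z ⊔ zpowers σ := by
  rw [eq_of_le_of_card_ge h.sup_le_normalizer (h.card_sup ▸ h.card_normalizer_le)]
  exact mem_normalizer_zpowers_iff.2 hg

/-- Modulo `⟨z⟩` the element becomes some `s ∈ ⟨σ⟩` whose order divides both `|z|` and `r`, which
are coprime. -/
lemma mem_of_pow_eq_one (h : IsSingerPair z σ r) {g : G} (hg : g ∈ zpowers z ⊔ zpowers σ)
    (h1 : g ^ orderOf z = 1) : g ∈ zpowers z := by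
  obtain ⟨t, ht, s, hs, rfl⟩ := h.exists_mul hg
  have key : ∀ n : ℕ, ∃ u ∈ zpowers z, (t * s) ^ n = u * s ^ n := by
    intro n
    induction n with
    | zero => exact ⟨1, one_mem _, by simp⟩
    | succ n ih =>
      obtain ⟨u, hu, e⟩ := ih
      refine ⟨t * (s * u * s⁻¹), mul_mem ht (h.conj_mem_of_mem (mem_sup_right hs) hu), ?_⟩
      rw [pow_succ', e, pow_succ']
      group
  obtain ⟨u, hu, e⟩ := key (orderOf z)
  rw [h1] at e
  have hs1 : s ^ orderOf z = 1 :=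
    h.eq_one_of_mem (by rw [← inv_eq_of_mul_eq_one_right e.symm]; exact inv_mem hu) (pow_mem hs _)
  have hs2 : s = 1 := by
    rw [← orderOf_eq_one_iff]
    exact Nat.eq_one_of_dvd_coprimes h.coprime (orderOf_dvd_of_pow_eq_one hs1)
      (h.orderOf_right ▸ orderOf_dvd_of_mem_zpowers hs)
  rwa [hs2, mul_one]

/-- Write `g = u * s`. Since `s` centralises no nontrivial element of `⟨z⟩`, the map `t ↦ t⁻¹ * (s *
t * s⁻¹)` is injective on the finite group `⟨z⟩`, hence hits `u`; then `g = t⁻¹ * s * t`. -/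
lemma exists_conj_mem (h : IsSingerPair z σ r) {g : G} (hg : g ∈ zpowers z ⊔ zpowers σ)
    (hgz : g ∉ zpowers z) : ∃ t ∈ zpowers z, t * g * t⁻¹ ∈ zpowers σ := by
  obtain ⟨u, hu, s, hs, rfl⟩ := h.exists_mul hg
  have hs1 : s ∉ zpowers z := fun hs' => hgz (mul_mem hu hs')
  let f : zpowers z → zpowers z := fun t =>
    ⟨(t : G)⁻¹ * (s * t * s⁻¹),
      mul_mem (inv_mem t.2) (h.conj_mem_of_mem (mem_sup_right hs) t.2)⟩
  have hf : Function.Injective f := by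
    rintro ⟨t, ht⟩ ⟨t', ht'⟩ e
    simp only [f, Subtype.mk.injEq] at e
    by_contra hne
    refine hs1 (h.mem_of_commute (t' * t⁻¹) (mul_mem ht' (inv_mem ht)) ?_ s ?_)
    · rw [Ne, mul_inv_eq_one]
      exact fun e' => hne (Subtype.ext e'.symm)
    · have e1 : t' * t⁻¹ * s * t = s * t' := by
        have := congrArg (fun x => t' * x * s) e
        simpa [mul_assoc] using this
      rw [commute_iff_eq, ← mul_assoc, ← e1]
      group
  obtain ⟨⟨t, ht⟩, e⟩ := (Finite.injective_iff_surjective.1 hf) ⟨u, hu⟩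
  simp only [f, Subtype.mk.injEq] at e
  refine ⟨t, ht, ?_⟩
  rw [← e]
  convert hs using 1
  group

/-- The complement is self-normalising in `H`: for the component `t ∈ ⟨z⟩` of `g`, the commutator of
`t` and `σ` lies in `⟨z⟩ ∩ ⟨σ⟩ = 1`, so `t` commutes with `σ` and must be trivial. -/
lemma mem_of_conj_mem (h : IsSingerPair z σ r) {g : G} (hg : g ∈ zpowers z ⊔ zpowers σ)
    (hgσ : g * σ * g⁻¹ ∈ zpowers σ) : g ∈ zpowers σ := by
  obtain ⟨t, ht, s, hs, rfl⟩ := h.exists_mul hg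
  have hss : s * σ * s⁻¹ = σ := by
    obtain ⟨n, rfl⟩ := hs
    rw [(Commute.self_zpow σ n).symm.eq, mul_inv_cancel_right]
  have e1 : t * s * σ * (t * s)⁻¹ = t * σ * t⁻¹ := by
    conv_rhs => rw [← hss]
    group
  rw [e1] at hgσ
  have e2 : t * (σ * t⁻¹ * σ⁻¹) = 1 := by
    refine h.eq_one_of_mem (mul_mem ht (h.conj_mem_of_mem (mem_sup_right (mem_zpowers σ))
      (inv_mem ht))) ?_
    convert mul_mem hgσ (inv_mem (mem_zpowers σ)) using 1
    group
  by_cases ht1 : t = 1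
  · rwa [ht1, one_mul]
  · refine absurd (h.eq_one_of_mem (h.mem_of_commute t ht ht1 σ ?_) (mem_zpowers σ)) h.right_ne_one
    rw [commute_iff_eq]
    rw [mul_eq_one_iff_eq_inv] at e2
    conv_rhs => rw [e2]
    group

end Group
end IsSingerPair

/-! ### Generalities on suborbits and bases -/

section Suborbits

open MulAction

lemma ncard_orbit_mul_card_stabilizer {H Ω : Type*} [Group H] [MulAction H Ω] (β : Ω) :
    (orbit H β).ncard * Nat.card (stabilizer H β) = Nat.card H := by
  rw [← index_stabilizer, Subgroup.index_mul_card]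

variable {G Ω : Type*} [Group G] [MulAction G Ω] (α : Ω)

lemma isBase_pair_iff {β : Ω} : IsBase G ({α, β} : Set Ω) ↔
    ∀ g ∈ stabilizer G α, g • β = β → g = 1 := by
  simp only [IsBase, Subgroup.eq_bot_iff_forall, mem_fixingSubgroup_iff, Set.mem_insert_iff,
    Set.mem_singleton_iff, forall_eq_or_imp, forall_eq, mem_stabilizer_iff, and_imp]

lemma ncard_setOf_ncard_orbit_eq [Finite Ω] (n : ℕ) :
    {β : Ω | (orbit (stabilizer G α) β).ncard = n}.ncard = subdegreeMultiplicity G α n * n := by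
  classical
  have hT : {S ∈ suborbits G α | S.ncard = n}.Finite := Set.toFinite _
  have hA : {β : Ω | (orbit (stabilizer G α) β).ncard = n}.Finite := Set.toFinite _
  rw [subdegreeMultiplicity, Set.ncard_eq_toFinset_card _ hT, Set.ncard_eq_toFinset_card _ hA,
    Finset.card_eq_sum_card_fiberwise (f := fun β => orbit (stabilizer G α) β)
      (t := hT.toFinset)]
  · refine Finset.sum_const_nat fun S hS => ?_
    obtain ⟨⟨β, rfl⟩, hn⟩ := hT.mem_toFinset.1 hS
    dsimp only at hn ⊢
    rw [← Set.ncard_coe_finset]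
    convert hn using 2
    ext γ
    simp only [Finset.coe_filter, Set.Finite.mem_toFinset, Set.mem_ofPred_eq, orbit_eq_iff]
    exact ⟨fun h => h.2, fun h => ⟨by rw [orbit_eq_iff.2 h, hn], h⟩⟩
  · intro β hβ
    simp only [Set.Finite.coe_toFinset, Set.mem_ofPred_eq] at hβ ⊢
    exact ⟨⟨β, rfl⟩, hβ⟩

lemma mem_subdegrees_iff {n : ℕ} :
    n ∈ subdegrees G α ↔ ∃ β : Ω, (orbit (stabilizer G α) β).ncard = n := by
  simp [subdegrees, suborbits]

lemma ncard_orbit_stabilizer_self : (orbit (stabilizer G α) α).ncard = 1 := by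
  rw [Set.ncard_eq_one]
  refine ⟨α, Set.eq_singleton_iff_unique_mem.2 ⟨mem_orbit_self _, ?_⟩⟩
  rintro _ ⟨g, rfl⟩
  exact g.2

lemma MulAction.finite_of_isPretransitive (G : Type*) {Ω : Type*} [Group G] [Finite G] [MulAction G Ω]
    [IsPretransitive G Ω] (α : Ω) : Finite Ω :=
  Finite.of_surjective (fun g : G => g • α) (exists_smul_eq G α)

lemma exists_free_of_baseSize_eq_two [IsPretransitive G Ω] (hb : baseSize G Ω = 2) :
    ∃ β : Ω, ∀ g ∈ stabilizer G α, g • β = β → g = 1 := by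
  classical
  obtain ⟨B, hB, hB2⟩ : 2 ∈ {n : ℕ | ∃ B : Finset Ω, IsBase G (B : Set Ω) ∧ B.card = n} := by
    rw [← hb]
    -- The infimum of the empty set is `0`, so base size 2 guarantees that some base exists.
    refine Nat.sInf_mem ?_
    by_contra hne
    rw [Set.not_nonempty_iff_eq_empty] at hne
    simp [baseSize, hne] at hb
  obtain ⟨x, y, -, rfl⟩ := Finset.card_eq_two.1 hB2
  rw [Finset.coe_pair, isBase_pair_iff] at hB
  obtain ⟨k, rfl⟩ := exists_smul_eq G α x
  -- Translating the base by `k⁻¹` moves its first point to `α`.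
  refine ⟨k⁻¹ • y, fun g hg hgy => ?_⟩
  rw [mem_stabilizer_iff] at hg
  have := hB (k * g * k⁻¹) (by simp [mul_smul, hg]) (by simp [mul_smul, hgy])
  simpa using this

end Suborbits

/-! ### Two-point stabilisers and fixed points of `σ` -/

namespace IsSingerPair

open Subgroup MulAction

lemma lt_mul {G : Type*} [Group G] {z σ : G} {r : ℕ} (h : IsSingerPair z σ r) : orderOf z <
    orderOf z * r :=
  lt_mul_of_one_lt_right (zero_lt_one.trans h.one_lt) h.prime.one_lt

variable {G Ω : Type*} [Group G] [Finite G] {z σ : G} {r : ℕ} [MulAction G Ω] {α β : Ω}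

lemma card_stabilizer (h : IsSingerPair z σ r)
    (hα : stabilizer G α = zpowers z ⊔ zpowers σ) :
    Nat.card (stabilizer G α) = orderOf z * r := by
  rw [hα, h.card_sup]

lemma ncard_orbit_of_free (h : IsSingerPair z σ r)
    (hα : stabilizer G α = zpowers z ⊔ zpowers σ)
    (hf : ∀ g ∈ stabilizer G α, g • β = β → g = 1) :
    (orbit (stabilizer G α) β).ncard = orderOf z * r := by
  have h1 := ncard_orbit_mul_card_stabilizer (H := stabilizer G α) β
  have h2 : stabilizer (stabilizer G α) β = ⊥ := by
    rw [eq_bot_iff_forall]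
    rintro ⟨g, hg⟩ hgβ
    exact Subtype.ext (hf g hg hgβ)
  rwa [h2, card_bot, mul_one, h.card_stabilizer hα] at h1

variable [IsPretransitive G Ω]

/-- Distinct conjugates of `⟨z⟩` meet trivially, and `H` is the full normaliser of `⟨z⟩`; hence the
kernel acts semiregularly away from `α`. -/
lemma eq_one_of_smul_eq (h : IsSingerPair z σ r)
    (hα : stabilizer G α = zpowers z ⊔ zpowers σ) (hβ : β ≠ α) {t : G} (ht : t ∈ zpowers z)
    (htβ : t • β = β) : t = 1 := by
  obtain ⟨g, rfl⟩ := exists_smul_eq G α β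
  by_contra ht1
  have h1 : g⁻¹ * t * g ∈ zpowers z := by
    refine h.mem_of_pow_eq_one ?_ ?_
    · rw [← hα, mem_stabilizer_iff, mul_smul, mul_smul, htβ, inv_smul_smul]
    · have := conj_pow (a := g⁻¹) (b := t) (i := orderOf z)
      rw [inv_inv] at this
      rw [this, orderOf_dvd_iff_pow_eq_one.1 (orderOf_dvd_of_mem_zpowers ht)]
      simp
  have h2 : g * z * g⁻¹ ∈ zpowers z := by
    refine h.mem_of_commute t ht ht1 _ ?_
    have h3 : Commute z (g⁻¹ * t * g) := by
      obtain ⟨n, hn⟩ := h1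
      rw [← hn]
      exact Commute.self_zpow z n
    have h4 := (Commute.conj_iff g).2 h3
    convert h4 using 1
    group
  have h3 := h.mem_of_conj h2
  rw [← hα] at h3
  exact hβ h3

lemma mem_zpowers_right_of_smul_eq (h : IsSingerPair z σ r)
    (hα : stabilizer G α = zpowers z ⊔ zpowers σ) (hβ : β ≠ α) (hσ : σ • β = β) {g : G}
    (hg : g ∈ stabilizer G α) (hgβ : g • β = β) : g ∈ zpowers σ := by
  rw [hα] at hg
  obtain ⟨t, ht, s, hs, rfl⟩ := h.exists_mul hg
  have hs1 : s • β = β := by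
    have : zpowers σ ≤ stabilizer G β := zpowers_le.2 hσ
    exact this hs
  rw [mul_smul, hs1] at hgβ
  rwa [h.eq_one_of_smul_eq hα hβ ht hgβ, one_mul]

lemma ncard_orbit_of_right_smul_eq (h : IsSingerPair z σ r)
    (hα : stabilizer G α = zpowers z ⊔ zpowers σ) (hβ : β ≠ α) (hσ : σ • β = β) :
    (orbit (stabilizer G α) β).ncard = orderOf z := by
  have h1 := ncard_orbit_mul_card_stabilizer (H := stabilizer G α) β
  have h2 : Nat.card (stabilizer (stabilizer G α) β) = r := by
    rw [← h.orderOf_right, ← Nat.card_zpowers,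
      ← card_subtype _ (stabilizer (stabilizer G α) β)]
    refine congrArg (fun K : Subgroup G => Nat.card K) (Subgroup.ext fun g => ?_)
    simp only [mem_map, mem_stabilizer_iff, Subtype.exists]
    constructor
    · rintro ⟨g, hg, hg1, rfl⟩
      exact h.mem_zpowers_right_of_smul_eq hα hβ hσ hg hg1
    · intro hg
      refine ⟨g, ?_, ?_, rfl⟩
      · rw [← mem_stabilizer_iff, hα]
        exact mem_sup_right hg
      · have : zpowers σ ≤ stabilizer G β := zpowers_le.2 hσ
        exact this hg
  rw [h2, h.card_stabilizer hα] at h1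
  exact Nat.eq_of_mul_eq_mul_right h.prime.pos h1

/-- A nontrivial element fixing `α` and `β` lies outside `⟨z⟩`, so some `t ∈ ⟨z⟩` conjugates it to a
generator of `⟨σ⟩`; the wanted point is `t • β`. -/
lemma exists_right_smul_eq (h : IsSingerPair z σ r)
    (hα : stabilizer G α = zpowers z ⊔ zpowers σ) (hβ : β ≠ α)
    (hf : ¬ ∀ g ∈ stabilizer G α, g • β = β → g = 1) :
    ∃ γ ∈ orbit (stabilizer G α) β, γ ≠ α ∧ σ • γ = γ := by
  push Not at hf
  obtain ⟨g, hg, hgβ, hg1⟩ := hf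
  obtain ⟨t, ht, htσ⟩ := h.exists_conj_mem (hα ▸ hg)
    fun hgz => hg1 (h.eq_one_of_smul_eq hα hβ hgz hgβ)
  have htα : t ∈ stabilizer G α := by
    rw [hα]
    exact mem_sup_left ht
  refine ⟨t • β, ⟨⟨t, htα⟩, rfl⟩, fun e => hβ ?_, ?_⟩
  · rw [smul_eq_iff_eq_inv_smul] at e
    rw [e]
    exact inv_mem htα
  · have h1 := h.zpowers_eq_of_mem htσ (by simpa using hg1)
    have h2 : σ ∈ zpowers (t * g * t⁻¹) := h1 ▸ mem_zpowers σ
    have h3 : zpowers (t * g * t⁻¹) ≤ stabilizer G (t • β) := by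
      rw [zpowers_le, mem_stabilizer_iff, mul_smul, mul_smul, inv_smul_smul, hgβ]
    exact h3 h2

lemma ncard_orbit_of_not_free (h : IsSingerPair z σ r)
    (hα : stabilizer G α = zpowers z ⊔ zpowers σ) (hβ : β ≠ α)
    (hf : ¬ ∀ g ∈ stabilizer G α, g • β = β → g = 1) :
    (orbit (stabilizer G α) β).ncard = orderOf z := by
  obtain ⟨γ, hγ, hγα, hγσ⟩ := h.exists_right_smul_eq hα hβ hf
  rw [← orbit_eq_iff.2 hγ, h.ncard_orbit_of_right_smul_eq hα hγα hγσ]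

/-- The number of fixed points of `σ` is `|N_G(⟨σ⟩)| / r`. -/
lemma ncard_fixedBy_mul (h : IsSingerPair z σ r)
    (hα : stabilizer G α = zpowers z ⊔ zpowers σ) :
    (fixedBy Ω σ).ncard * r = Nat.card (normalizer (zpowers σ : Set G)) := by
  rw [← ncard_orbit_mul_card_stabilizer (H := normalizer (zpowers σ : Set G)) α]
  congr 1
  · congr 1
    ext β
    rw [mem_fixedBy]
    constructor
    · obtain ⟨g, rfl⟩ := exists_smul_eq G α β
      intro hg
      -- Transitivity of the normaliser on fixed points: `g⁻¹ * σ * g` is an element of `H` of order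
      -- `r`, so some `t ∈ ⟨z⟩` conjugates it into `⟨σ⟩`. Then `t * g⁻¹` normalises `⟨σ⟩`, and its
      -- inverse sends `α` to `g • α`.
      have h1 : g⁻¹ * σ * g ∈ zpowers z ⊔ zpowers σ := by
        rw [← hα, mem_stabilizer_iff, mul_smul, mul_smul, hg, inv_smul_smul]
      have h2 : g⁻¹ * σ * g ∉ zpowers z := by
        intro h2
        refine h.right_ne_one ?_
        have h3 : orderOf (g⁻¹ * σ * g) = r := by
          rw [← h.orderOf_right]
          simpa using (MulAut.conj g⁻¹).orderOf_eq σ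
        have h4 := Nat.eq_one_of_dvd_coprimes h.coprime (orderOf_dvd_of_mem_zpowers h2) h3.dvd
        rw [h3] at h4
        exact absurd h4 h.prime.one_lt.ne'
      obtain ⟨t, ht, htσ⟩ := h.exists_conj_mem h1 h2
      have ht' : t * g⁻¹ ∈ normalizer (zpowers σ : Set G) := by
        rw [mem_normalizer_zpowers_iff]
        convert htσ using 1
        group
      refine ⟨⟨(t * g⁻¹)⁻¹, inv_mem ht'⟩, ?_⟩
      have : t⁻¹ • α = α := by
        rw [← mem_stabilizer_iff, hα]
        exact inv_mem (mem_sup_left ht)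
      change (t * g⁻¹)⁻¹ • α = _
      rw [mul_inv_rev, inv_inv, mul_smul, this]
    · rintro ⟨⟨g, hg⟩, rfl⟩
      change σ • g • α = g • α
      have h1 := mem_normalizer_zpowers_iff.1 (inv_mem hg)
      rw [← inv_smul_eq_iff, smul_smul, smul_smul, ← mem_stabilizer_iff, hα]
      convert mem_sup_right h1 using 1
      group
  · rw [← h.orderOf_right, ← Nat.card_zpowers,
      ← card_subtype _ (stabilizer (normalizer (zpowers σ : Set G)) α)]
    refine congrArg (fun K : Subgroup G => Nat.card K) (Subgroup.ext fun g => ?_)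
    simp only [mem_map, mem_stabilizer_iff, Subtype.exists]
    constructor
    · intro hg
      refine ⟨g, le_normalizer hg, ?_, rfl⟩
      change g • α = α
      rw [← mem_stabilizer_iff, hα]
      exact mem_sup_right hg
    · rintro ⟨g, hg, hg1, rfl⟩
      change g • α = α at hg1
      rw [← mem_stabilizer_iff, hα] at hg1
      exact h.mem_of_conj_mem hg1 (mem_normalizer_zpowers_iff.1 hg)

end IsSingerPair

/-! ### Subdegrees, multiplicities and the valency -/

namespace IsSingerPair

open Subgroup MulAction

variable {G Ω : Type*} [Group G] [Finite G] {z σ : G} {r : ℕ} [MulAction G Ω] {α : Ω}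
  [IsPretransitive G Ω]

lemma ncard_orbit_eq_one_iff (h : IsSingerPair z σ r)
    (hα : stabilizer G α = zpowers z ⊔ zpowers σ) {β : Ω} :
    (orbit (stabilizer G α) β).ncard = 1 ↔ β = α := by
  constructor
  · intro h1
    by_contra hβ
    have := h.one_lt
    have := h.lt_mul
    by_cases hf : ∀ g ∈ stabilizer G α, g • β = β → g = 1
    · rw [h.ncard_orbit_of_free hα hf] at h1
      lia
    · rw [h.ncard_orbit_of_not_free hα hβ hf] at h1
      lia
  · rintro rfl
    exact ncard_orbit_stabilizer_self _

lemma ncard_orbit_eq_mul_iff (h : IsSingerPair z σ r)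
    (hα : stabilizer G α = zpowers z ⊔ zpowers σ) {β : Ω} :
    (orbit (stabilizer G α) β).ncard = orderOf z * r ↔
      ∀ g ∈ stabilizer G α, g • β = β → g = 1 := by
  refine ⟨fun h1 => ?_, h.ncard_orbit_of_free hα⟩
  have := h.one_lt
  have := h.lt_mul
  by_contra hf
  rcases eq_or_ne β α with rfl | hβ
  · rw [ncard_orbit_stabilizer_self] at h1
    lia
  · rw [h.ncard_orbit_of_not_free hα hβ hf] at h1
    lia

lemma ncard_orbit_cases (h : IsSingerPair z σ r)
    (hα : stabilizer G α = zpowers z ⊔ zpowers σ) (β : Ω) :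
    (orbit (stabilizer G α) β).ncard = 1 ∨ (orbit (stabilizer G α) β).ncard = orderOf z * r ∨
      (orbit (stabilizer G α) β).ncard = orderOf z := by
  rcases eq_or_ne β α with rfl | hβ
  · exact Or.inl (ncard_orbit_stabilizer_self _)
  · by_cases hf : ∀ g ∈ stabilizer G α, g • β = β → g = 1
    · exact Or.inr (Or.inl (h.ncard_orbit_of_free hα hf))
    · exact Or.inr (Or.inr (h.ncard_orbit_of_not_free hα hβ hf))

lemma saxlValency_eq (h : IsSingerPair z σ r)
    (hα : stabilizer G α = zpowers z ⊔ zpowers σ) :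
    saxlValency G α = {β : Ω | (orbit (stabilizer G α) β).ncard = orderOf z * r}.ncard := by
  rw [saxlValency]
  congr 1
  ext β
  rw [SimpleGraph.mem_neighborSet, Set.mem_ofPred_eq, h.ncard_orbit_eq_mul_iff hα]
  change α ≠ β ∧ IsBase G _ ↔ _
  rw [isBase_pair_iff, and_iff_right_iff_imp]
  rintro hf rfl
  refine h.right_ne_one (hf σ ?_ ?_)
  · rw [hα]
    exact mem_sup_right (mem_zpowers σ)
  · rw [← mem_stabilizer_iff, hα]
    exact mem_sup_right (mem_zpowers σ)

lemma subdegreeMultiplicity_one (h : IsSingerPair z σ r)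
    (hα : stabilizer G α = zpowers z ⊔ zpowers σ) : subdegreeMultiplicity G α 1 = 1 := by
  have := finite_of_isPretransitive G α
  have h1 := ncard_setOf_ncard_orbit_eq (G := G) α 1
  simp only [h.ncard_orbit_eq_one_iff hα, mul_one] at h1
  rw [← h1, Set.ncard_eq_one]
  exact ⟨α, rfl⟩

lemma subdegreeMultiplicity_mul (h : IsSingerPair z σ r)
    (hα : stabilizer G α = zpowers z ⊔ zpowers σ) :
    subdegreeMultiplicity G α (orderOf z * r) * (orderOf z * r) = saxlValency G α := by
  have := finite_of_isPretransitive G α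
  rw [h.saxlValency_eq hα, ncard_setOf_ncard_orbit_eq]

lemma subdegreeMultiplicity_orderOf (h : IsSingerPair z σ r)
    (hα : stabilizer G α = zpowers z ⊔ zpowers σ) :
    subdegreeMultiplicity G α (orderOf z) + 1 = (fixedBy Ω σ).ncard := by
  have := finite_of_isPretransitive G α
  have hαF : α ∈ fixedBy Ω σ := by
    rw [mem_fixedBy, ← mem_stabilizer_iff, hα]
    exact mem_sup_right (mem_zpowers σ)
  rw [← Set.ncard_sdiff_singleton_add_one hαF, subdegreeMultiplicity]
  congr 1
  -- The orbits of length `|z|` are parametrised by the fixed points of `σ` other than `α`.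
  have : {S ∈ suborbits G α | S.ncard = orderOf z} =
      (fun β => orbit (stabilizer G α) β) '' (fixedBy Ω σ \ {α}) := by
    ext S
    constructor
    · rintro ⟨⟨β, rfl⟩, hβ⟩
      dsimp only at hβ
      have h1 := h.one_lt
      have h2 := h.lt_mul
      have hβα : β ≠ α := by
        rw [Ne, ← h.ncard_orbit_eq_one_iff hα]
        lia
      obtain ⟨γ, hγ, hγα, hγσ⟩ := h.exists_right_smul_eq hα hβα
        (by rw [← h.ncard_orbit_eq_mul_iff hα]; lia)
      exact ⟨γ, ⟨hγσ, hγα⟩, orbit_eq_iff.2 hγ⟩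
    · rintro ⟨β, ⟨hβ, hβα⟩, rfl⟩
      exact ⟨⟨β, rfl⟩, h.ncard_orbit_of_right_smul_eq hα hβα hβ⟩
  rw [this, Set.InjOn.ncard_image]
  -- If `g ∈ H` carries one fixed point `γ` of `σ` to another, then `g⁻¹ * σ * g` fixes `γ` and so
  -- lies in `⟨σ⟩`. Thus `g` is in `N_H(⟨σ⟩) = ⟨σ⟩` and fixes `γ`.
  rintro β ⟨hβ, hβα⟩ γ ⟨hγ, hγα⟩ hβγ
  obtain ⟨⟨g, hg⟩, rfl⟩ := orbit_eq_iff.1 hβγ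
  have hg' : g • γ ≠ α := hβα
  have hg'' : σ • g • γ = g • γ := hβ
  have hσ : σ ∈ stabilizer G α := hαF
  have h1 : g⁻¹ * σ * g ∈ zpowers σ := by
    refine h.mem_zpowers_right_of_smul_eq hα hγα hγ (mul_mem (mul_mem (inv_mem hg) hσ) hg) ?_
    rw [mul_smul, mul_smul, hg'', inv_smul_smul]
  have h2 : g⁻¹ ∈ zpowers σ := h.mem_of_conj_mem (by rw [← hα]; exact inv_mem hg)
    (by rwa [inv_inv])
  have h3 : zpowers σ ≤ stabilizer G γ := zpowers_le.2 hγ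
  exact h3 (inv_mem_iff.1 h2)

lemma card_eq (h : IsSingerPair z σ r)
    (hα : stabilizer G α = zpowers z ⊔ zpowers σ) :
    (stabilizer G α).index =
      1 + saxlValency G α + subdegreeMultiplicity G α (orderOf z) * orderOf z := by
  have := finite_of_isPretransitive G α
  have h1 := h.one_lt
  have h2 := h.lt_mul
  -- The summand `1` is written as a multiplicity times a length, so that all three summands count
  -- points by orbit length.
  rw [index_stabilizer, orbit_eq_univ, h.saxlValency_eq hα, ← ncard_setOf_ncard_orbit_eq,
    show 1 = subdegreeMultiplicity G α 1 * 1 by rw [h.subdegreeMultiplicity_one hα],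
    ← ncard_setOf_ncard_orbit_eq, ← Set.ncard_union_eq, ← Set.ncard_union_eq]
  · congr 1
    ext β
    simpa [or_assoc] using h.ncard_orbit_cases hα β
  · rw [Set.disjoint_left]
    rintro β (hβ | hβ) hβ' <;> simp only [Set.mem_ofPred_eq] at hβ hβ' <;> lia
  · rw [Set.disjoint_left]
    rintro β hβ hβ'
    simp only [Set.mem_ofPred_eq] at hβ hβ'
    lia

theorem subdegree_structure (h : IsSingerPair z σ r)
    (hα : stabilizer G α = zpowers z ⊔ zpowers σ)
    (hN : ∃ g ∈ normalizer (zpowers σ : Set G), g ∉ zpowers σ) :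
    subdegrees G α ⊆ {1, orderOf z * r, orderOf z} ∧
    {1, orderOf z} ⊆ subdegrees G α ∧
    (baseSize G Ω = 2 → subdegrees G α = {1, orderOf z * r, orderOf z}) := by
  have h1 : subdegrees G α ⊆ {1, orderOf z * r, orderOf z} := by
    intro n hn
    obtain ⟨β, rfl⟩ := (mem_subdegrees_iff α).1 hn
    exact h.ncard_orbit_cases hα β
  have h2 : {1, orderOf z} ⊆ subdegrees G α := by
    rintro n (rfl | rfl) <;> rw [mem_subdegrees_iff]
    · exact ⟨α, ncard_orbit_stabilizer_self α⟩
    · obtain ⟨g, hg, hgσ⟩ := hN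
      refine ⟨g • α, h.ncard_orbit_of_right_smul_eq hα (fun e => hgσ ?_) ?_⟩
      · refine h.mem_of_conj_mem ?_ (mem_normalizer_zpowers_iff.1 hg)
        rwa [← hα]
      · rw [← inv_smul_eq_iff, smul_smul, smul_smul, ← mem_stabilizer_iff, hα]
        refine mem_sup_right ?_
        convert mem_normalizer_zpowers_iff.1 (inv_mem hg) using 1
        group
  refine ⟨h1, h2, fun hb => h1.antisymm ?_⟩
  rintro n (rfl | rfl | rfl)
  · exact h2 (by simp)
  · obtain ⟨β, hβ⟩ := exists_free_of_baseSize_eq_two (G := G) α hb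
    exact (mem_subdegrees_iff α).2 ⟨β, h.ncard_orbit_of_free hα hβ⟩
  · exact h2 (by simp)

theorem multiplicity_structure (h : IsSingerPair z σ r)
    (hα : stabilizer G α = zpowers z ⊔ zpowers σ) {N : ℕ}
    (hN : N = Nat.card (normalizer (zpowers σ : Set G))) :
    subdegreeMultiplicity G α 1 = 1 ∧
    (subdegreeMultiplicity G α (orderOf z * r) : ℚ) =
      (saxlValency G α : ℚ) / (orderOf z * r : ℕ) ∧
    (subdegreeMultiplicity G α (orderOf z) : ℚ) = ((N : ℚ) - r) / r ∧
    (saxlValency G α : ℚ) = ((stabilizer G α).index : ℚ) + orderOf z - 1 - orderOf z * N / r := by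
  have hr : (r : ℚ) ≠ 0 := by exact_mod_cast h.prime.ne_zero
  have hz : (orderOf z : ℚ) ≠ 0 := by exact_mod_cast (zero_lt_one.trans h.one_lt).ne'
  have h1 := h.ncard_fixedBy_mul hα
  rw [← hN, ← h.subdegreeMultiplicity_orderOf hα] at h1
  have h2 := h.subdegreeMultiplicity_mul hα
  refine ⟨h.subdegreeMultiplicity_one hα, ?_, ?_, ?_⟩
  · rw [eq_div_iff (by push_cast; exact mul_ne_zero hz hr), ← h2]
    push_cast
    ring
  · rw [← h1]
    push_cast
    field_simp
    ring
  · rw [h.card_eq hα, ← h1]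
    push_cast
    field_simp
    ring

end IsSingerPair

/-! ### Arithmetic of `(q ^ r - ε) / (q - ε)` -/

section Arithmetic

variable {q r a : ℕ} {ε : ℤˣ}

lemma sub_units_pos (hq : 2 ≤ q) (ε : ℤˣ) : 0 < (q : ℤ) - ε := by
  rcases Int.units_eq_one_or ε with rfl | rfl <;> push_cast <;> lia

lemma units_pow_odd (hodd : Odd r) : (ε : ℤ) ^ r = ε := by
  rcases Int.units_eq_one_or ε with rfl | rfl <;> simp [hodd.neg_one_pow]

/-- By Fermat `q ^ r ≡ q` modulo `r`, so `r ∣ a` would force `r ∣ q - ε`. -/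
lemma coprime_of_mul_eq (hr : r.Prime) (hcop : Int.gcd ((q : ℤ) - ε) r = 1)
    (ha : (a : ℤ) * ((q : ℤ) - ε) = (q : ℤ) ^ r - ε) : a.Coprime r := by
  have : Fact r.Prime := ⟨hr⟩
  rw [Nat.coprime_comm, hr.coprime_iff_not_dvd]
  intro h
  have h1 : (r : ℤ) ∣ (q : ℤ) - ε := by
    rw [← ZMod.intCast_zmod_eq_zero_iff_dvd]
    have := congrArg (Int.cast : ℤ → ZMod r) ha
    rw [Int.cast_mul, Int.cast_natCast, (ZMod.natCast_eq_zero_iff a r).2 h, zero_mul] at this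
    rw [this]
    simp
  have h2 := Int.dvd_gcd h1 dvd_rfl
  rw [hcop] at h2
  exact hr.one_lt.ne' (Nat.dvd_one.1 (by exact_mod_cast h2))

lemma one_lt_of_mul_eq (hq : 2 ≤ q) (hr : 1 < r)
    (ha : (a : ℤ) * ((q : ℤ) - ε) = (q : ℤ) ^ r - ε) : 1 < a := by
  by_contra! h
  have h0 := sub_units_pos hq ε
  have h1 : (a : ℤ) * ((q : ℤ) - ε) ≤ 1 * ((q : ℤ) - ε) := by
    gcongr
    exact_mod_cast h
  have h2 : (q : ℤ) ^ 1 < (q : ℤ) ^ r := pow_lt_pow_right₀ (by exact_mod_cast hq) hr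
  lia

/-- If `q ≡ ε` modulo `s`, every term of the geometric sum for `a` is `ε ^ (r - 1) = 1`, so `a ≡ r`
and `s = r`, contrary to `a` and `r` being coprime. -/
lemma prime_not_dvd_sub (hq : 2 ≤ q) (hr : r.Prime) (hodd : Odd r)
    (hcop : Int.gcd ((q : ℤ) - ε) r = 1)
    (ha : (a : ℤ) * ((q : ℤ) - ε) = (q : ℤ) ^ r - ε) {s : ℕ} (hs : s.Prime) (hsa : s ∣ a) :
    ¬ (s : ℤ) ∣ (q : ℤ) - ε := by
  intro h
  have ha' : (a : ℤ) = ∑ i ∈ Finset.range r, (q : ℤ) ^ i * (ε : ℤ) ^ (r - 1 - i) := by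
    refine mul_right_cancel₀ (sub_units_pos hq ε).ne' ?_
    rw [geom_sum₂_mul, ha, units_pow_odd hodd]
  have h1 : (q : ZMod s) = ((ε : ℤ) : ZMod s) := by
    rw [← sub_eq_zero]
    exact_mod_cast (ZMod.intCast_zmod_eq_zero_iff_dvd _ s).2 h
  have h2 := congrArg (Int.cast : ℤ → ZMod s) ha'
  have h3 : ∀ i ∈ Finset.range r,
      ((ε : ℤ) : ZMod s) ^ i * ((ε : ℤ) : ZMod s) ^ (r - 1 - i) = 1 := by
    intro i hi
    rw [← pow_add, show i + (r - 1 - i) = r - 1 by have := Finset.mem_range.1 hi; lia]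
    have : Even (r - 1) := by
      obtain ⟨k, rfl⟩ := hodd
      simp
    rcases Int.units_eq_one_or ε with rfl | rfl <;> simp [this.neg_one_pow]
  push_cast at h2
  rw [(ZMod.natCast_eq_zero_iff a s).2 hsa, h1, Finset.sum_congr rfl h3] at h2
  simp only [Finset.sum_const, Finset.card_range, nsmul_eq_mul, mul_one] at h2
  have h4 : s ∣ r := (ZMod.natCast_eq_zero_iff r s).1 h2.symm
  rw [(Nat.prime_dvd_prime_iff_eq hs hr).1 h4] at hsa
  exact hr.one_lt.ne' (Nat.Coprime.eq_one_of_dvd (coprime_of_mul_eq hr hcop ha).symm hsa)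

lemma prime_ne_two (hq : 2 ≤ q) (hr : r.Prime) (hodd : Odd r)
    (hcop : Int.gcd ((q : ℤ) - ε) r = 1)
    (ha : (a : ℤ) * ((q : ℤ) - ε) = (q : ℤ) ^ r - ε) {s : ℕ} (hs : s.Prime) (hsa : s ∣ a) :
    s ≠ 2 := by
  rintro rfl
  have h1 := prime_not_dvd_sub hq hr hodd hcop ha hs hsa
  have h2 : (2 : ℤ) ∣ (q : ℤ) ^ r - ε := by
    rw [← ha]
    exact dvd_mul_of_dvd_left (by exact_mod_cast hsa) _
  refine h1 ?_
  have h3 : (2 : ℤ) ∣ (q : ℤ) ^ r - q := by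
    rw [← even_iff_two_dvd, Int.even_sub, Int.even_pow]
    exact and_iff_left hr.ne_zero
  have := dvd_sub h2 h3
  rwa [show (q : ℤ) ^ r - ε - (q ^ r - q) = q - ε by ring] at this

/-- In the unitary case `q ^ 2 ≡ 1` with `q ≢ -1` gives `q ≡ 1`; then `q ^ r + 1 ≡ 0` reads `2 ≡ 0`,
which fails because `s` is odd. -/
lemma prime_not_dvd_card_sub (hq : 2 ≤ q) (hr : r.Prime) (hodd : Odd r)
    (hcop : Int.gcd ((q : ℤ) - ε) r = 1)
    (ha : (a : ℤ) * ((q : ℤ) - ε) = (q : ℤ) ^ r - ε) {s : ℕ} (hs : s.Prime) (hsa : s ∣ a) :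
    ((if ε = 1 then q else q ^ 2 : ℕ) : ZMod s) ≠ 1 := by
  have : Fact s.Prime := ⟨hs⟩
  have h1 := prime_not_dvd_sub hq hr hodd hcop ha hs hsa
  rw [← ZMod.intCast_zmod_eq_zero_iff_dvd] at h1
  rcases Int.units_eq_one_or ε with rfl | rfl
  · simpa [sub_eq_zero] using h1
  · rw [if_neg (by decide)]
    push_cast at h1 ⊢
    rw [sub_neg_eq_add, add_eq_zero_iff_eq_neg] at h1
    intro h2
    have h3 := (mul_self_eq_one_iff.1 ((sq _).symm.trans h2)).resolve_right h1
    have h4 := congrArg (Int.cast : ℤ → ZMod s) ha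
    push_cast at h4
    rw [(ZMod.natCast_eq_zero_iff a s).2 hsa, h3] at h4
    have h5 : ((2 : ℕ) : ZMod s) = 0 := by
      push_cast
      linear_combination -h4
    rw [ZMod.natCast_eq_zero_iff, Nat.prime_dvd_prime_iff_eq hs Nat.prime_two] at h5
    exact prime_ne_two hq hr hodd hcop ha hs hsa h5

lemma card_pow_eq_one (ha : (a : ℤ) * ((q : ℤ) - ε) = (q : ℤ) ^ r - ε) {s : ℕ} (hsa : s ∣ a) :
    ((if ε = 1 then q else q ^ 2 : ℕ) : ZMod s) ^ r = 1 := by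
  have h2 := congrArg (Int.cast : ℤ → ZMod s) ha
  push_cast at h2
  rw [(ZMod.natCast_eq_zero_iff a s).2 hsa, zero_mul, eq_comm, sub_eq_zero] at h2
  rcases Int.units_eq_one_or ε with rfl | rfl
  · simpa using h2
  · rw [if_neg (by decide)]
    push_cast at h2 ⊢
    rw [← pow_mul, mul_comm, pow_mul, h2]
    ring

end Arithmetic

/-! ### Matrices of prime order have irreducible minimal polynomial -/

section

open Polynomial

section
variable {F : Type*} [Field F] [Finite F] {r : ℕ}

/-- A root of `f` in `F[X] / (f)` has order `s`, so `s` divides `|F| ^ deg f - 1`. The order of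
`|F|` modulo `s` is `r`, hence `r ∣ deg f`. -/
lemma dvd_natDegree_of_dvd {f : F[X]} (hf : Irreducible f) {s : ℕ} (hs : s.Prime)
    (hr : r.Prime) (hfs : f ∣ X ^ s - 1) (hf1 : ¬ f ∣ X - 1)
    (h1 : (Nat.card F : ZMod s) ≠ 1) (hQr : (Nat.card F : ZMod s) ^ r = 1) :
    r ∣ f.natDegree := by
  have : Fact (Irreducible f) := ⟨hf⟩
  have : Fact s.Prime := ⟨hs⟩
  have : Fact r.Prime := ⟨hr⟩
  let K := AdjoinRoot f
  have : Module.Finite F K := (AdjoinRoot.powerBasis hf.ne_zero).finite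
  have hK : Nat.card K = Nat.card F ^ f.natDegree := by
    rw [Module.natCard_eq_pow_finrank (K := F), (AdjoinRoot.powerBasis hf.ne_zero).finrank,
      AdjoinRoot.powerBasis_dim]
  have : Finite K := Module.finite_of_finite F
  let b : K := AdjoinRoot.root f
  have hb : b ^ s = 1 := by
    have := AdjoinRoot.mk_eq_zero.2 hfs
    rwa [map_sub, map_pow, AdjoinRoot.mk_X, map_one, sub_eq_zero] at this
  have hb1 : b ≠ 1 := by
    intro hb1
    refine hf1 (AdjoinRoot.mk_eq_zero.1 ?_)
    rw [map_sub, AdjoinRoot.mk_X, map_one, sub_eq_zero]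
    exact hb1
  have hb0 : b ≠ 0 := by
    intro h0
    rw [h0, zero_pow hs.ne_zero] at hb
    exact zero_ne_one hb
  have hord : orderOf b = s := orderOf_eq_prime hb hb1
  have hd : s ∣ Nat.card F ^ f.natDegree - 1 := by
    rw [← hord, ← hK]
    have := Fintype.ofFinite K
    rw [Nat.card_eq_fintype_card]
    exact orderOf_dvd_of_pow_eq_one (FiniteField.pow_card_sub_one_eq_one b hb0)
  rw [← orderOf_eq_prime hQr h1]
  refine orderOf_dvd_of_pow_eq_one ?_
  rw [← Nat.cast_pow]
  have h3 : 1 ≤ Nat.card F ^ f.natDegree := Nat.one_le_pow _ _ Nat.card_pos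
  have := (ZMod.natCast_eq_zero_iff _ s).2 hd
  rwa [Nat.cast_sub h3, Nat.cast_one, sub_eq_zero] at this

/-- Since `A ≠ 1` and the minimal polynomial is squarefree, it has an irreducible factor other than
`X - 1`. That factor has degree at least `r`, which already exhausts the degree available. -/
theorem irreducible_minpoly_of_pow_eq_one {A : Matrix (Fin r) (Fin r) F} {s : ℕ} (hs : s.Prime)
    (hr : r.Prime) (hA : A ^ s = 1) (hA1 : A ≠ 1) (hsF : (s : F) ≠ 0)
    (h1 : (Nat.card F : ZMod s) ≠ 1) (hQr : (Nat.card F : ZMod s) ^ r = 1) :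
    Irreducible (minpoly F A) ∧ (minpoly F A).natDegree = r := by
  have hint : IsIntegral F A := Algebra.IsIntegral.isIntegral A
  have hms : minpoly F A ∣ X ^ s - 1 := minpoly.dvd F A (by simp [hA])
  have hsq : Squarefree (minpoly F A) :=
    (Polynomial.X_pow_sub_one_separable_iff.2 hsF).squarefree.squarefree_of_dvd hms
  have hdeg : (minpoly F A).natDegree ≤ r := by
    have h2 := natDegree_le_of_dvd (Matrix.minpoly_dvd_charpoly A) A.charpoly_monic.ne_zero
    rwa [Matrix.charpoly_natDegree_eq_dim, Fintype.card_fin] at h2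
  have hX1 : Irreducible (X - 1 : F[X]) := by simpa using irreducible_X_sub_C (1 : F)
  obtain ⟨f, hf, hfm, hf1⟩ : ∃ f : F[X], Irreducible f ∧ f ∣ minpoly F A ∧ ¬ f ∣ X - 1 := by
    by_contra! hcon
    refine hA1 ?_
    have h2 : minpoly F A ∣ X - 1 := by
      have hu : ¬ IsUnit (minpoly F A) := by
        have : NeZero r := ⟨hr.ne_zero⟩
        exact minpoly.not_isUnit F A
      obtain ⟨f, hf, g, hg⟩ := WfDvdMonoid.exists_irreducible_factor hu (minpoly.ne_zero hint)
      have hfX := hcon f hf ⟨g, hg⟩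
      -- With all irreducible factors associated to `X - 1`, a nonunit cofactor would give a
      -- repeated factor.
      by_cases hgu : IsUnit g
      · rw [hg]
        exact (hgu.mul_right_dvd).2 hfX
      · have hg0 : g ≠ 0 := right_ne_zero_of_mul (hg ▸ minpoly.ne_zero hint)
        obtain ⟨f', hf', hf'g⟩ := WfDvdMonoid.exists_irreducible_factor hgu hg0
        have hf'X := hcon f' hf' (hf'g.trans ⟨f, by rw [hg, mul_comm]⟩)
        have hff' : f ∣ f' := ((hf.associated_of_dvd hX1 hfX).trans
          (hf'.associated_of_dvd hX1 hf'X).symm).dvd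
        exact absurd (hsq f (hg ▸ mul_dvd_mul_left f (hff'.trans hf'g))) hf.not_isUnit
    have h3 := (minpoly.dvd_iff).1 h2
    simpa [sub_eq_zero] using h3
  have h2 := Nat.le_of_dvd hf.natDegree_pos
    (dvd_natDegree_of_dvd hf hs hr (hfm.trans hms) hf1 h1 hQr)
  have h3 := natDegree_le_of_dvd hfm (minpoly.ne_zero hint)
  have h4 : Associated f (minpoly F A) :=
    associated_of_dvd_of_natDegree_le hfm (minpoly.ne_zero hint) (hdeg.trans h2)
  exact ⟨h4.irreducible hf, by lia⟩

end

end

/-! ### The field `F[A]` and its centraliser -/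

section

open Polynomial

section

variable {F : Type*} [Field F] {r : ℕ} {A : Matrix (Fin r) (Fin r) F}

/-- The evaluation embedding of the field `F[X] / (minpoly A)` into the matrix algebra. -/
noncomputable def adjoinRootMinpolyHom (A : Matrix (Fin r) (Fin r) F) :
    AdjoinRoot (minpoly F A) →ₐ[F] Matrix (Fin r) (Fin r) F :=
  Ideal.Quotient.liftₐ (Ideal.span {minpoly F A}) (aeval A) fun p hp => by
    obtain ⟨g, rfl⟩ := Ideal.mem_span_singleton.1 hp
    rw [map_mul, minpoly.aeval, zero_mul]

lemma adjoinRootMinpolyHom_mk (p : F[X]) :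
    adjoinRootMinpolyHom A (AdjoinRoot.mk _ p) = aeval A p :=
  rfl

variable [Fact (Irreducible (minpoly F A))]

lemma adjoinRootMinpolyHom_injective [NeZero r] : Function.Injective (adjoinRootMinpolyHom A) :=
  (adjoinRootMinpolyHom A).toRingHom.injective

lemma finrank_adjoinRoot_minpoly :
    Module.finrank F (AdjoinRoot (minpoly F A)) = (minpoly F A).natDegree := by
  have h0 := (Fact.out : Irreducible (minpoly F A)).ne_zero
  rw [(AdjoinRoot.powerBasis h0).finrank, AdjoinRoot.powerBasis_dim]

variable [NeZero r]

/-- Over the field `F[A]` of degree `r`, the space `F ^ r` is one-dimensional. A matrix commuting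
with `A` is `F[A]`-linear, hence a scalar of that field. -/
theorem exists_adjoinRoot_eq_of_commute (hdeg : (minpoly F A).natDegree = r)
    {B : Matrix (Fin r) (Fin r) F} (hB : Commute B A) :
    ∃ x : AdjoinRoot (minpoly F A), adjoinRootMinpolyHom A x = B := by
  have h0 := (Fact.out : Irreducible (minpoly F A)).ne_zero
  have : Module.Finite F (AdjoinRoot (minpoly F A)) := (AdjoinRoot.powerBasis h0).finite
  have hcomm : ∀ x, Commute B (adjoinRootMinpolyHom A x) := by
    intro x
    obtain ⟨p, rfl⟩ := AdjoinRoot.mk_surjective x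
    rw [adjoinRootMinpolyHom_mk]
    exact (Polynomial.aeval_eq_sum_range (p := p) A) ▸ Commute.sum_right _ _ _
      fun i _ => (hB.pow_right i).smul_right _
  have key : ∀ v : Fin r → F, v ≠ 0 → Function.Bijective
      (fun x : AdjoinRoot (minpoly F A) => (adjoinRootMinpolyHom A x).mulVec v) := by
    intro v hv
    let f : AdjoinRoot (minpoly F A) →ₗ[F] (Fin r → F) :=
      { toFun := fun x => (adjoinRootMinpolyHom A x).mulVec v
        map_add' := fun x y => by simp [Matrix.add_mulVec]
        map_smul' := fun c x => by simp [Matrix.smul_mulVec] }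
    have hf : Function.Injective f := by
      rw [← LinearMap.ker_eq_bot, LinearMap.ker_eq_bot']
      intro x hx
      by_contra hx0
      refine hv ?_
      have h2 : (adjoinRootMinpolyHom A (x⁻¹ * x)).mulVec v = 0 := by
        rw [map_mul, ← Matrix.mulVec_mulVec]
        change Matrix.mulVec _ (f x) = 0
        rw [hx, Matrix.mulVec_zero]
      rwa [inv_mul_cancel₀ hx0, map_one, Matrix.one_mulVec] at h2
    refine ⟨hf, (LinearMap.injective_iff_surjective_of_finrank_eq_finrank ?_).1 hf⟩
    rw [finrank_adjoinRoot_minpoly, hdeg, Module.finrank_fin_fun]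
  have hv : (Pi.single 0 1 : Fin r → F) ≠ 0 := by simp
  obtain ⟨x, hx⟩ := (key _ hv).2 (B.mulVec (Pi.single 0 1))
  dsimp only at hx
  refine ⟨x, Matrix.ext_of_mulVec_single fun i => ?_⟩
  obtain ⟨y, hy⟩ := (key _ hv).2 (Pi.single i 1)
  dsimp only at hy
  rw [← hy, Matrix.mulVec_mulVec, Matrix.mulVec_mulVec, (hcomm y).eq, ← map_mul, mul_comm,
    map_mul, ← Matrix.mulVec_mulVec, hx, Matrix.mulVec_mulVec]

/-- Matrices `S i` that conjugate `A` to distinct elements of the field `F[A]` are linearly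
independent. -/
theorem linearIndependent_of_mul_eq {ι : Type*} {S : ι → Matrix (Fin r) (Fin r) F}
    (hS : ∀ i, S i ≠ 0) {x : ι → AdjoinRoot (minpoly F A)} (hx : Function.Injective x)
    (h : ∀ i, S i * A = adjoinRootMinpolyHom A (x i) * S i) : LinearIndependent F S := by
  let : Module (AdjoinRoot (minpoly F A)) (Matrix (Fin r) (Fin r) F) :=
    Module.compHom _ (adjoinRootMinpolyHom A).toRingHom
  have hsmul : ∀ (k : AdjoinRoot (minpoly F A)) (M : Matrix (Fin r) (Fin r) F),
    k • M = adjoinRootMinpolyHom A k * M := fun _ _ => rfl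
  have : IsScalarTower F (AdjoinRoot (minpoly F A)) (Matrix (Fin r) (Fin r) F) :=
    ⟨fun c k M => by simp [hsmul]⟩
  -- With `F[A]` acting on matrices by left multiplication, right multiplication by `A` is linear
  -- and the `S i` are eigenvectors for the distinct eigenvalues `x i`.
  let f : Module.End (AdjoinRoot (minpoly F A)) (Matrix (Fin r) (Fin r) F) :=
    { toFun := fun M => M * A
      map_add' := fun M N => add_mul M N A
      map_smul' := fun k M => by simp [hsmul, mul_assoc] }
  have := Module.End.eigenvectors_linearIndependent' f x hx S fun i => by
    rw [Module.End.hasEigenvector_iff, Module.End.mem_eigenspace_iff]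
    exact ⟨h i, hS i⟩
  exact this.restrict_scalars' F

end

end

section

open Polynomial

/-! ### Centralisers and normalisers of tori in projective groups -/

/-- A cyclic group has at most `m` solutions of `x ^ m = 1`; for `m = orderOf u` the powers of `u`
are all of them. -/
lemma mem_zpowers_of_isCyclic {G : Type*} [Group G] {R : Subgroup G} [Finite R] [IsCyclic R]
    {u v : G} (hu : u ∈ R) (hv : v ∈ R) (huv : v ^ orderOf u = 1) : v ∈ Subgroup.zpowers u := by
  classical
  have := Fintype.ofFinite R
  have hu0 : 0 < orderOf (⟨u, hu⟩ : R) := orderOf_pos _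
  have h1 := IsCyclic.card_pow_eq_one_le (α := R) hu0
  have h2 : ((Subgroup.zpowers (⟨u, hu⟩ : R) : Set R).toFinset) ⊆
      Finset.univ.filter fun x : R => x ^ orderOf (⟨u, hu⟩ : R) = 1 := by
    intro x hx
    rw [Set.mem_toFinset] at hx
    simpa using orderOf_dvd_iff_pow_eq_one.1 (orderOf_dvd_of_mem_zpowers hx)
  have h3 := Finset.eq_of_subset_of_card_le h2 (h1.trans (by
    rw [← Nat.card_zpowers, ← Set.ncard_eq_toFinset_card', ← Nat.card_coe_set_eq]
    rfl))
  have h4 : (⟨v, hv⟩ : R) ∈ Finset.univ.filter fun x : R => x ^ orderOf (⟨u, hu⟩ : R) = 1 := by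
    simp only [Finset.mem_filter, Finset.mem_univ, true_and]
    rw [Subgroup.orderOf_mk]
    exact Subtype.ext huv
  rw [← h3, Set.mem_toFinset] at h4
  obtain ⟨n, hn⟩ := h4
  exact ⟨n, by simpa using congrArg Subtype.val hn⟩

section Lift

variable {F : Type*} [Field F] {r : ℕ}

open Matrix ProjGenLinGroup

lemma scalar_injective [NeZero r] :
    Function.Injective (GeneralLinearGroup.scalar (Fin r) : Fˣ →* GL (Fin r) F) :=
  fun _ _ h => Units.ext (Matrix.scalar_inj.1 (congrArg Units.val h))

/-- For any lift `X`, the matrix `X ^ s` is a scalar of order dividing `n`. Raising `X` to a power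
`m` with `m ≡ 1` mod `s` and `m ≡ 0` mod `n` kills that scalar without changing the image. -/
lemma exists_lift_pow_eq_one {U : Subgroup (GL (Fin r) F)} {n s : ℕ}
    (hU : ∀ c : Fˣ, GeneralLinearGroup.scalar (Fin r) c ∈ U → c ^ n = 1) (hs : s.Coprime n)
    {x : PGL(r, F)} (hx : x ∈ U.map mk) (hxs : x ^ s = 1) :
    ∃ X ∈ U, mk X = x ∧ X ^ s = 1 := by
  obtain ⟨X, hX, rfl⟩ := hx
  obtain ⟨c, hc⟩ : ∃ c : Fˣ, GeneralLinearGroup.scalar (Fin r) c = X ^ s := by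
    rw [← map_pow, mk_eq_one, GeneralLinearGroup.center_eq_range_scalar] at hxs
    exact hxs
  have hcn := hU c (hc ▸ pow_mem hX s)
  obtain ⟨m, hm1, hm2⟩ := Nat.chineseRemainder hs 1 0
  refine ⟨X ^ m, pow_mem hX m, ?_, ?_⟩
  · rw [map_pow, pow_eq_pow_mod m hxs, hm1, ← pow_eq_pow_mod 1 hxs, pow_one]
  · obtain ⟨l, rfl⟩ := (Nat.modEq_zero_iff_dvd.1 hm2)
    rw [← pow_mul, mul_comm, pow_mul, ← hc, ← map_pow, pow_mul, hcn, one_pow, map_one]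

/-- `B * A * B⁻¹` is `A` times a scalar whose order divides both `s` and `|F| - 1`, hence is 1. -/
lemma commute_of_commute_mk [Finite F] [NeZero r] {A B : GL (Fin r) F} {s : ℕ}
    (hs : s.Coprime (Nat.card F - 1)) (hA : A ^ s = 1) (h : Commute (mk B) (mk A)) :
    Commute B A := by
  have h1 : mk (B * A * B⁻¹) = mk A := by
    rw [map_mul, map_mul, h.eq, map_inv, mul_inv_cancel_right]
  obtain ⟨c, hc⟩ := mk_eq_mk_iff.1 h1
  have hcomm : Commute (B * A * B⁻¹) (GeneralLinearGroup.scalar (Fin r) c) :=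
    (Subgroup.mem_center_iff.1 (by
      rw [GeneralLinearGroup.center_eq_range_scalar]; exact ⟨c, rfl⟩) _)
  have h2 : GeneralLinearGroup.scalar (Fin r) (c ^ s) = 1 := by
    have := congrArg (· ^ s) hc
    simpa [hcomm.mul_pow, conj_pow, hA] using this
  have h3 : c ^ s = 1 := by
    rw [← map_one (GeneralLinearGroup.scalar (Fin r))] at h2
    exact scalar_injective h2
  have h4 : c ^ (Nat.card F - 1) = 1 := by
    rw [← Nat.card_units]
    exact pow_card_eq_one'
  have h5 : c = 1 := by
    rw [← orderOf_eq_one_iff]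
    exact Nat.eq_one_of_dvd_coprimes hs (orderOf_dvd_of_pow_eq_one h3)
      (orderOf_dvd_of_pow_eq_one h4)
  rw [h5, map_one, mul_one, mul_inv_eq_iff_eq_mul] at hc
  exact hc

end Lift

section Field

variable {F K : Type*} [Field F] [Finite F] [Field K] [Finite K] [Algebra F K]

/-- Such an `x` satisfies `x ^ |F| = x`, so it is fixed by the Galois group, which consists of
powers of Frobenius. -/
lemma mem_range_algebraMap_of_pow_eq_one {n : ℕ} (hn : n ∣ Nat.card F - 1) {x : K}
    (hx : x ^ n = 1) : x ∈ Set.range (algebraMap F K) := by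
  obtain ⟨p, hp⟩ := CharP.exists F
  have : Fact p.Prime := ⟨CharP.char_is_prime F p⟩
  have : IsGalois F K := inferInstance
  rw [IsGalois.mem_range_algebraMap_iff_fixed]
  intro g
  obtain ⟨i, hi⟩ := FiniteField.exists_forall_apply_eq_pow F p K g
  have h1 : x ^ Nat.card F = x := by
    obtain ⟨m, hm⟩ := hn
    have h2 : Nat.card F = n * m + 1 := by
      rw [← hm, Nat.sub_add_cancel Nat.card_pos]
    rw [h2, pow_succ, pow_mul, hx, one_pow, one_mul]
  rw [hi]
  clear hi
  induction i with
  | zero => simp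
  | succ i ih => rw [pow_succ, pow_mul, ih, h1]

end Field

lemma mul_aeval_eq_of_mul_eq {F R : Type*} [CommSemiring F] [Semiring R] [Algebra F R] {A A' B : R}
    (h : B * A = A' * B) (p : F[X]) : B * aeval A p = aeval A' p * B := by
  have h1 : SemiconjBy B A A' := h
  induction p using Polynomial.induction_on' with
  | add p q hp hq => simp only [map_add, mul_add, add_mul, hp, hq]
  | monomial n c =>
    rw [aeval_monomial, aeval_monomial, mul_assoc, ← (h1.pow_right n).eq, ← mul_assoc, ← mul_assoc,
      Algebra.commutes]

end

/-! ### Tori in projective groups: the Singer pair property -/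

section

open Polynomial Matrix ProjGenLinGroup

instance finite_projGenLinGroup {F : Type*} [Field F] [Finite F] {r : ℕ} : Finite PGL(r, F) :=
  Finite.of_surjective _ mk_surjective

lemma Subgroup.card_eq_card_toFinset {G : Type*} [Group G] (H : Subgroup G)
    [Fintype (H : Set G)] : Nat.card H = (H : Set G).toFinset.card := by
  rw [← Set.ncard_eq_toFinset_card', ← Nat.card_coe_set_eq, SetLike.coe_sort_coe]

/-- The properties of the subgroup `U` of `GL_r(F)` and of the numbers `n = q - ε` and
`a = (q ^ r - ε) / (q - ε)` for `U = GL_r^ε(q)`. -/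
structure HasTorusArithmetic {F : Type*} [Field F] {r : ℕ} (U : Subgroup (GL (Fin r) F))
    (n a : ℕ) : Prop where
  scalar_pow : ∀ c : Fˣ, GeneralLinearGroup.scalar (Fin r) c ∈ U → c ^ n = 1
  dvd_card_sub_one : n ∣ Nat.card F - 1
  card_ne_one : ∀ s : ℕ, s.Prime → s ∣ a → (Nat.card F : ZMod s) ≠ 1
  card_pow_eq_one : ∀ s : ℕ, s.Prime → s ∣ a → (Nat.card F : ZMod s) ^ r = 1
  pow_eq_one : ∀ A ∈ U, A ^ a = 1 → Irreducible (minpoly F A.1) → (minpoly F A.1).natDegree = r →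
    ∀ B ∈ U, Commute B A → B ^ (a * n) = 1

namespace HasTorusArithmetic

variable {F : Type*} [Field F] [Finite F] {r n a : ℕ} {U : Subgroup (GL (Fin r) F)}

lemma coprime_card_sub_one (h : HasTorusArithmetic U n a) {s : ℕ} (hs : s.Prime) (hsa : s ∣ a) :
    s.Coprime (Nat.card F - 1) := by
  rw [hs.coprime_iff_not_dvd, ← ZMod.natCast_eq_zero_iff, Nat.cast_sub Nat.card_pos, Nat.cast_one,
    sub_eq_zero]
  exact h.card_ne_one s hs hsa

lemma natCast_ne_zero (h : HasTorusArithmetic U n a) (hr : r ≠ 0) {s : ℕ} (hs : s.Prime)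
    (hsa : s ∣ a) : (s : F) ≠ 0 := by
  intro h0
  have : Fact s.Prime := ⟨hs⟩
  have := (CharP.charP_iff_prime_eq_zero hs).2 h0
  have h1 := h.card_pow_eq_one s hs hsa
  have := Fintype.ofFinite F
  obtain ⟨m, -, hm⟩ := FiniteField.card F s
  rw [Nat.card_eq_fintype_card, hm] at h1
  simp [hr] at h1

lemma irreducible_minpoly (h : HasTorusArithmetic U n a) (hr : r.Prime) {s : ℕ} (hs : s.Prime)
    (hsa : s ∣ a) {A : GL (Fin r) F} (hA : A ^ s = 1) (hA1 : A ≠ 1) :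
    Irreducible (minpoly F A.1) ∧ (minpoly F A.1).natDegree = r :=
  irreducible_minpoly_of_pow_eq_one hs hr (by simpa using congrArg Units.val hA)
    (fun h1 => hA1 (Units.ext h1)) (h.natCast_ne_zero hr.ne_zero hs hsa) (h.card_ne_one s hs hsa)
    (h.card_pow_eq_one s hs hsa)

/-- A nontrivial element of prime order dividing `a` lifts to an element of `U` of the same order,
which generates a field. -/
lemma exists_lift (h : HasTorusArithmetic U n a) (hr : r.Prime) {s : ℕ} (hs : s.Prime)
    (hsa : s ∣ a) {y : PGL(r, F)} (hy : y ∈ U.map ProjGenLinGroup.mk) (hys : y ^ s = 1) (hy1 : y ≠ 1) :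
    ∃ A ∈ U, ProjGenLinGroup.mk A = y ∧ A ^ s = 1 ∧ Irreducible (minpoly F A.1) ∧
      (minpoly F A.1).natDegree = r := by
  obtain ⟨A, hA, rfl, hAs⟩ := exists_lift_pow_eq_one h.scalar_pow
    ((h.coprime_card_sub_one hs hsa).coprime_dvd_right h.dvd_card_sub_one) hy hys
  refine ⟨A, hA, rfl, hAs, h.irreducible_minpoly hr hs hsa hAs ?_⟩
  rintro rfl
  simp at hy1

/-- Elements of the group commuting with `y` lift into `F[A]ˣ`, so they lie in a cyclic group, and
they have `a`-th power 1. In a cyclic group these all belong to the subgroup of order `a`, which is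
`⟨z⟩`. -/
theorem mem_zpowers_of_commute (h : HasTorusArithmetic U n a) (hr : r.Prime) {s : ℕ}
    (hs : s.Prime) (hsa : s ∣ a) {y z g : PGL(r, F)} (hy : y ∈ U.map ProjGenLinGroup.mk) (hys : y ^ s = 1)
    (hy1 : y ≠ 1) (hz : z ∈ U.map ProjGenLinGroup.mk) (hza : orderOf z = a) (hzy : Commute z y)
    (hg : g ∈ U.map ProjGenLinGroup.mk) (hgy : Commute g y) : g ∈ Subgroup.zpowers z := by
  have : NeZero r := ⟨hr.ne_zero⟩
  obtain ⟨A, hA, rfl, hAs, hirr, hdeg⟩ := h.exists_lift hr hs hsa hy hys hy1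
  have : Fact (Irreducible (minpoly F A.1)) := ⟨hirr⟩
  have : Module.Finite F (AdjoinRoot (minpoly F A.1)) :=
    (AdjoinRoot.powerBasis hirr.ne_zero).finite
  have : Finite (AdjoinRoot (minpoly F A.1)) := Module.finite_of_finite F
  let θ : (AdjoinRoot (minpoly F A.1))ˣ →* PGL(r, F) :=
    ProjGenLinGroup.mk.comp (Units.map (adjoinRootMinpolyHom A.1).toMonoidHom)
  have key : ∀ g ∈ U.map ProjGenLinGroup.mk, Commute g (ProjGenLinGroup.mk A) → g ∈ θ.range ∧ g ^ a = 1 := by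
    rintro _ ⟨B, hB, rfl⟩ hBA
    have hcomm := commute_of_commute_mk (h.coprime_card_sub_one hs hsa) hAs hBA
    have hBn := h.pow_eq_one A hA (by obtain ⟨k, rfl⟩ := hsa; rw [pow_mul, hAs, one_pow])
      hirr hdeg B hB hcomm
    obtain ⟨x, hx⟩ := exists_adjoinRoot_eq_of_commute hdeg (hcomm.map (Units.coeHom _))
    have hx' : adjoinRootMinpolyHom A.1 x = B.1 := hx
    have hx0 : x ≠ 0 := by
      rintro rfl
      rw [map_zero] at hx'
      exact B.ne_zero hx'.symm
    refine ⟨⟨Units.mk0 x hx0, congrArg ProjGenLinGroup.mk (Units.ext hx')⟩, ?_⟩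
    -- As `n ∣ |F| - 1`, this places `x ^ a` in `F`, so `B ^ a` is scalar and dies in `PGL`.
    have hxn : (x ^ a) ^ n = 1 := by
      apply adjoinRootMinpolyHom_injective (A := A.1)
      rw [← pow_mul, map_pow, hx', map_one, ← Units.val_pow_eq_pow_val, hBn, Units.val_one]
    obtain ⟨c, hc⟩ := mem_range_algebraMap_of_pow_eq_one h.dvd_card_sub_one hxn
    have hc0 : c ≠ 0 := by
      rintro rfl
      rw [map_zero] at hc
      exact pow_ne_zero a hx0 hc.symm
    have hBa : B ^ a = GeneralLinearGroup.scalar (Fin r) (Units.mk0 c hc0) := by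
      ext1
      rw [Units.val_pow_eq_pow_val, ← hx', ← map_pow, ← hc, AlgHom.commutes]
      rfl
    rw [← map_pow, hBa, mk_scalar]
  have := isCyclic_of_surjective θ.rangeRestrict θ.rangeRestrict_surjective
  have := Finite.of_surjective θ.rangeRestrict θ.rangeRestrict_surjective
  refine mem_zpowers_of_isCyclic (key z hz hzy).1 (key g hg hgy).1 ?_
  rw [hza]
  exact (key g hg hgy).2

/-- A normalising element conjugates `A` to a root of its minimal polynomial inside `F[A]`, leaving
at most `r` possibilities. Two elements giving the same root differ by an element centralising `z ^
l`, hence by one of the `a` elements of `⟨z⟩`. -/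
theorem card_normalizer_le (h : HasTorusArithmetic U n a) (hr : r.Prime) (ha : 1 < a)
    {z : U.map (ProjGenLinGroup.mk (n := Fin r) (R := F))} (hza : orderOf z = a) :
    Nat.card (Subgroup.normalizer (Subgroup.zpowers z : Set (U.map ProjGenLinGroup.mk))) ≤ a * r := by
  classical
  have : NeZero r := ⟨hr.ne_zero⟩
  obtain ⟨s, hs, hsa⟩ := Nat.exists_prime_and_dvd ha.ne'
  obtain ⟨l, hl⟩ := hsa
  have hzl : orderOf (z ^ l) = s := by
    have hl0 : l ≠ 0 := by
      rintro rfl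
      lia
    rw [orderOf_pow_of_dvd hl0 (by rw [hza, hl]; exact dvd_mul_left l s), hza, hl,
      Nat.mul_div_cancel _ (Nat.pos_of_ne_zero hl0)]
  have hsa : s ∣ a := ⟨l, hl⟩
  have hy1 : (z ^ l : U.map ProjGenLinGroup.mk).1 ≠ 1 := by
    intro h1
    have : z ^ l = 1 := Subtype.ext h1
    rw [this, orderOf_one] at hzl
    exact hs.one_lt.ne hzl
  have hys : (z ^ l : U.map ProjGenLinGroup.mk).1 ^ s = 1 := by
    rw [← SubgroupClass.coe_pow, ← hzl, pow_orderOf_eq_one, OneMemClass.coe_one]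
  obtain ⟨A, hA, hAy, hAs, hirr, hdeg⟩ := h.exists_lift hr hs hsa (z ^ l).2 hys hy1
  have : Fact (Irreducible (minpoly F A.1)) := ⟨hirr⟩
  have hzcomm : Commute z.1 (z ^ l : U.map ProjGenLinGroup.mk).1 := (Commute.self_pow z l).map (Subgroup.subtype _)
  have hlift : ∀ g : U.map ProjGenLinGroup.mk, ∃ B : GL (Fin r) F, ProjGenLinGroup.mk B = g := fun g => mk_surjective g.1
  choose B hB using hlift
  have hx : ∀ g ∈ Subgroup.normalizer (Subgroup.zpowers z : Set (U.map ProjGenLinGroup.mk)),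
      ∃ x, adjoinRootMinpolyHom A.1 x = (B g * A * (B g)⁻¹ : GL (Fin r) F).1 := by
    intro g hg
    suffices hc : Commute (B g * A * (B g)⁻¹) A from
      exists_adjoinRoot_eq_of_commute hdeg (hc.map (Units.coeHom _))
    refine commute_of_commute_mk (h.coprime_card_sub_one hs hsa) hAs ?_
    rw [map_mul, map_mul, map_inv, hAy, hB]
    obtain ⟨k, hk⟩ := (hg (z ^ l)).1 (Subgroup.npow_mem_zpowers z l)
    have hk' : (g : PGL(r, F)) * (z ^ l : U.map ProjGenLinGroup.mk).1 * (g : PGL(r, F))⁻¹ = z.1 ^ k := by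
      rw [← SubgroupClass.coe_zpow]
      exact congrArg Subtype.val hk.symm
    rw [hk']
    exact hzcomm.zpow_left k
  choose! x hx using hx
  let p := (minpoly F A.1).map (algebraMap F (AdjoinRoot (minpoly F A.1)))
  have hp : p ≠ 0 := by
    rw [Polynomial.map_ne_zero_iff (algebraMap F _).injective]
    exact hirr.ne_zero
  have hcard : p.roots.toFinset.card ≤ r :=
    (Multiset.toFinset_card_le _).trans ((card_roots' p).trans (by rw [natDegree_map, hdeg]))
  have := Fintype.ofFinite (U.map (ProjGenLinGroup.mk (n := Fin r) (R := F)))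
  let N := (Subgroup.normalizer (Subgroup.zpowers z : Set (U.map ProjGenLinGroup.mk)) :
    Set (U.map (ProjGenLinGroup.mk (n := Fin r) (R := F)))).toFinset
  have hmaps : ∀ g ∈ N, x g ∈ p.roots.toFinset := by
    intro g hg
    rw [Multiset.mem_toFinset, mem_roots hp, IsRoot, eval_map_algebraMap]
    apply adjoinRootMinpolyHom_injective (A := A.1)
    rw [← aeval_algHom_apply, hx g (Set.mem_toFinset.1 hg), map_zero]
    have h1 : (B g).1 * A.1 = (B g * A * (B g)⁻¹ : GL (Fin r) F).1 * (B g).1 := by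
      rw [← Units.val_mul, ← Units.val_mul, inv_mul_cancel_right]
    have h2 := mul_aeval_eq_of_mul_eq h1 (minpoly F A.1)
    rw [minpoly.aeval, mul_zero] at h2
    exact ((B g).isUnit.mul_left_eq_zero).1 h2.symm
  have hfib : ∀ b ∈ p.roots.toFinset, (N.filter fun g => x g = b).card ≤ a := by
    intro b _
    rcases (N.filter fun g => x g = b).eq_empty_or_nonempty with h0 | ⟨g₀, hg₀⟩
    · simp [h0]
    · rw [← hza, ← Nat.card_zpowers, Subgroup.card_eq_card_toFinset]
      refine Finset.card_le_card_of_injOn (fun g => g₀⁻¹ * g) ?_ (mul_right_injective g₀⁻¹).injOn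
      intro g hg
      obtain ⟨hg₀N, hg₀b⟩ := Finset.mem_filter.1 hg₀
      obtain ⟨hgN, hgb⟩ := Finset.mem_filter.1 hg
      have h1 : B g * A * (B g)⁻¹ = B g₀ * A * (B g₀)⁻¹ := by
        ext1
        rw [← hx g (Set.mem_toFinset.1 hgN), ← hx g₀ (Set.mem_toFinset.1 hg₀N), hgb, hg₀b]
      have h2 : Commute ((B g₀)⁻¹ * B g) A := by
        rw [mul_inv_eq_iff_eq_mul] at h1
        rw [commute_iff_eq, mul_assoc, h1]
        group
      have h3 := h.mem_zpowers_of_commute hr hs hsa (z ^ l).2 hys hy1 z.2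
        ((Subgroup.orderOf_coe z).trans hza) hzcomm (g₀⁻¹ * g).2 (by
          have := h2.map ProjGenLinGroup.mk
          rwa [map_mul, map_inv, hB, hB, hAy] at this)
      obtain ⟨k, hk⟩ := h3
      simp only [Finset.mem_coe, Set.mem_toFinset]
      exact ⟨k, Subtype.ext (by simpa using hk)⟩
  have h4 := Finset.card_le_mul_card_image_of_maps_to hmaps a hfib
  rw [Subgroup.card_eq_card_toFinset]
  exact h4.trans (Nat.mul_le_mul_left a hcard)

theorem isSingerPair (h : HasTorusArithmetic U n a) (hr : r.Prime) (ha : 1 < a)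
    (hra : a.Coprime r) {z σ : U.map (ProjGenLinGroup.mk (n := Fin r) (R := F))} (hza : orderOf z = a)
    (hσ : orderOf σ = r) (hconj : σ * z * σ⁻¹ ∈ Subgroup.zpowers z) : IsSingerPair z σ r where
  prime := hr
  orderOf_right := hσ
  one_lt := hza ▸ ha
  coprime := hza ▸ hra
  conj_mem := hconj
  card_normalizer_le := hza ▸ h.card_normalizer_le hr ha hza
  mem_of_commute := by
    intro y hy hy1 g hgy
    -- Replacing `y` by a power of prime order only enlarges its centraliser.
    obtain ⟨s, hs, l, hl⟩ := Nat.exists_prime_and_dvd (orderOf_eq_one_iff.not.2 hy1)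
    have hl0 : l ≠ 0 := by
      rintro rfl
      exact (orderOf_pos y).ne' hl
    have hyl : orderOf (y ^ l) = s := by
      rw [orderOf_pow_of_dvd hl0 (by rw [hl]; exact dvd_mul_left l s), hl,
        Nat.mul_div_cancel _ (Nat.pos_of_ne_zero hl0)]
    have hyl1 : (y ^ l).1 ≠ 1 := by
      intro h1
      have : y ^ l = 1 := Subtype.ext h1
      rw [this, orderOf_one] at hyl
      exact hs.one_lt.ne hyl
    have hyls : (y ^ l).1 ^ s = 1 := by
      rw [← SubgroupClass.coe_pow, ← hyl, pow_orderOf_eq_one, OneMemClass.coe_one]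
    have hsa : s ∣ a := by
      rw [← hza]
      exact (Dvd.intro l hl.symm).trans (orderOf_dvd_of_mem_zpowers hy)
    have hzy : Commute z y := by
      obtain ⟨k, rfl⟩ := hy
      exact Commute.self_zpow z k
    obtain ⟨k, hk⟩ := h.mem_zpowers_of_commute hr hs hsa (y ^ l).2 hyls hyl1 z.2
      ((Subgroup.orderOf_coe z).trans hza)
      ((hzy.pow_right l).map (Subgroup.subtype _)) g.2
      ((hgy.pow_right l).map (Subgroup.subtype _))
    exact ⟨k, Subtype.ext (by simpa using hk)⟩

end HasTorusArithmetic

end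

section

open Polynomial Matrix

/-! ### The groups `GL_r^ε(q)` -/

section GLEps

variable {p k r : ℕ} {F : Type*} [Field F] [ExpChar F p]

lemma GLEps_one : GLEps p k r F 1 = ⊤ := if_pos rfl

lemma GLEps_neg_one : GLEps p k r F (-1) = generalUnitary p k r F := if_neg (by decide)

lemma mem_generalUnitary {A : GL (Fin r) F} : A ∈ generalUnitary p k r F ↔
    A.1 * (A.1.map (iterateFrobenius F p k))ᵀ = 1 := Iff.rfl

lemma pow_of_scalar_mem_generalUnitary [NeZero r] {c : Fˣ}
    (hc : GeneralLinearGroup.scalar (Fin r) c ∈ generalUnitary p k r F) :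
    c ^ (p ^ k + 1) = 1 := by
  rw [mem_generalUnitary] at hc
  have h1 := congrFun (congrFun hc 0) 0
  ext
  simpa [Matrix.scalar_apply, Matrix.diagonal_map, iterateFrobenius_def, pow_succ'] using h1

variable [Finite F]

lemma card_adjoinRoot_minpoly {A : Matrix (Fin r) (Fin r) F} [Fact (Irreducible (minpoly F A))]
    (hdeg : (minpoly F A).natDegree = r) :
    Finite (AdjoinRoot (minpoly F A)) ∧ Nat.card (AdjoinRoot (minpoly F A)) = Nat.card F ^ r := by
  have h0 := (Fact.out : Irreducible (minpoly F A)).ne_zero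
  have : Module.Finite F (AdjoinRoot (minpoly F A)) := (AdjoinRoot.powerBasis h0).finite
  exact ⟨Module.finite_of_finite F, by
    rw [Module.natCard_eq_pow_finrank (K := F), finrank_adjoinRoot_minpoly, hdeg]⟩

lemma pow_card_pow_sub_one_eq_one_of_commute [NeZero r] {A B : GL (Fin r) F}
    (hirr : Irreducible (minpoly F A.1)) (hdeg : (minpoly F A.1).natDegree = r)
    (h : Commute B A) : B ^ (Nat.card F ^ r - 1) = 1 := by
  have : Fact (Irreducible (minpoly F A.1)) := ⟨hirr⟩
  obtain ⟨hfin, hcard⟩ := card_adjoinRoot_minpoly hdeg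
  obtain ⟨x, hx⟩ := exists_adjoinRoot_eq_of_commute hdeg (h.map (Units.coeHom _))
  have hx' : adjoinRootMinpolyHom A.1 x = B.1 := hx
  have hx0 : x ≠ 0 := by
    rintro rfl
    rw [map_zero] at hx'
    exact B.ne_zero hx'.symm
  have := Fintype.ofFinite (AdjoinRoot (minpoly F A.1))
  ext1
  rw [← hcard, Nat.card_eq_fintype_card, Units.val_pow_eq_pow_val, ← hx', ← map_pow,
    FiniteField.pow_card_sub_one_eq_one x hx0, map_one, Units.val_one]

/-- For odd `r`, `q ^ r` is `q` times a power of `|F|`. -/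
lemma pow_pow_eq_of_card_eq_sq {q : ℕ} (hF : Nat.card F = q ^ 2) (hr : Odd r) (c : F) :
    c ^ q ^ r = c ^ q := by
  obtain ⟨m, rfl⟩ := hr
  have := Fintype.ofFinite F
  rw [pow_succ q, pow_mul, pow_mul q, ← hF, Nat.card_eq_fintype_card, FiniteField.pow_card_pow]

/-- Conjugate transposition acts on `F[A]` as the power map `x ↦ x ^ (q ^ r)`, `q = p ^ k`: both are
additive and they agree on monomials `c * A ^ n`. Thus unitarity of an element of `F[A]` becomes `x
^ (q ^ r + 1) = 1`. -/
lemma map_pow_eq_transpose {A : Matrix (Fin r) (Fin r) F} [Fact (Irreducible (minpoly F A))]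
    (hF : Nat.card F = (p ^ k) ^ 2) (hr : Odd r)
    (hA : (A.map (iterateFrobenius F p k))ᵀ = A ^ (p ^ k) ^ r) (x : AdjoinRoot (minpoly F A)) :
    adjoinRootMinpolyHom A (x ^ (p ^ k) ^ r) =
      ((adjoinRootMinpolyHom A x).map (iterateFrobenius F p k))ᵀ := by
  have : ExpChar (AdjoinRoot (minpoly F A)) p :=
    expChar_of_injective_algebraMap (algebraMap F _).injective p
  obtain ⟨f, rfl⟩ := AdjoinRoot.mk_surjective x
  induction f using Polynomial.induction_on' with
  | add f g hf hg =>
    rw [map_add, ← pow_mul, add_pow_expChar_pow, pow_mul, map_add, hf, hg, map_add, Matrix.map_add,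
      transpose_add]
    exact map_add _
  | monomial n c =>
    rw [← map_pow, adjoinRootMinpolyHom_mk, adjoinRootMinpolyHom_mk, map_pow, aeval_monomial,
      ← Algebra.smul_def, _root_.smul_pow, pow_pow_eq_of_card_eq_sq hF hr, ← pow_mul, mul_comm n, pow_mul,
      ← hA, ← transpose_pow]
    have h1 : (A ^ n).map (iterateFrobenius F p k) = (A.map (iterateFrobenius F p k)) ^ n :=
      map_pow ((iterateFrobenius F p k).mapMatrix) A n
    rw [← h1, ← transpose_smul]
    congr 1
    ext i j
    simp [iterateFrobenius_def, mul_pow]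

lemma pow_add_one_eq_one_of_commute [NeZero r] {A B : GL (Fin r) F}
    (hF : Nat.card F = (p ^ k) ^ 2) (hr : Odd r)
    (hA : A ∈ generalUnitary p k r F) (hA1 : A ^ ((p ^ k) ^ r + 1) = 1)
    (hirr : Irreducible (minpoly F A.1)) (hdeg : (minpoly F A.1).natDegree = r)
    (hB : B ∈ generalUnitary p k r F) (h : Commute B A) : B ^ ((p ^ k) ^ r + 1) = 1 := by
  have : Fact (Irreducible (minpoly F A.1)) := ⟨hirr⟩
  obtain ⟨x, hx⟩ := exists_adjoinRoot_eq_of_commute hdeg (h.map (Units.coeHom _))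
  have hx' : adjoinRootMinpolyHom A.1 x = B.1 := hx
  have hA2 : (A.1.map (iterateFrobenius F p k))ᵀ = A.1 ^ (p ^ k) ^ r := by
    have h1 : A.1 * A.1 ^ (p ^ k) ^ r = 1 := by
      rw [← pow_succ', ← Units.val_pow_eq_pow_val, hA1, Units.val_one]
    have h2 := mem_generalUnitary.1 hA
    rw [← h2] at h1
    exact (A.isUnit.mul_left_cancel h1).symm
  have h3 := map_pow_eq_transpose hF hr hA2 x
  rw [map_pow, hx'] at h3
  ext1
  rw [Units.val_pow_eq_pow_val, pow_succ', h3, mem_generalUnitary.1 hB, Units.val_one]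

theorem hasTorusArithmetic_GLEps {q a n : ℕ} {ε : ℤˣ} (hq : q = p ^ k) (hq2 : 2 ≤ q)
    (hr : r.Prime) (hodd : Odd r) (hF : Nat.card F = if ε = 1 then q else q ^ 2)
    (hcop : Int.gcd ((q : ℤ) - ε) r = 1) (ha : (a : ℤ) * ((q : ℤ) - ε) = (q : ℤ) ^ r - ε)
    (hn : (n : ℤ) = (q : ℤ) - ε) : HasTorusArithmetic (GLEps p k r F ε) n a where
  scalar_pow := by
    have : NeZero r := ⟨hr.ne_zero⟩
    intro c hc
    rcases Int.units_eq_one_or ε with rfl | rfl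
    · have : n = Nat.card F - 1 := by
        rw [hF, if_pos rfl]
        push_cast at hn
        lia
      rw [this, ← Nat.card_units]
      exact pow_card_eq_one'
    · have : n = p ^ k + 1 := by
        rw [← hq]
        push_cast at hn
        lia
      rw [this]
      rw [GLEps_neg_one] at hc
      exact pow_of_scalar_mem_generalUnitary hc
  dvd_card_sub_one := by
    rcases Int.units_eq_one_or ε with rfl | rfl
    · rw [hF, if_pos rfl]
      push_cast at hn
      exact (show n = q - 1 by lia).dvd
    · rw [hF, if_neg (by decide)]
      push_cast at hn
      rw [show n = q + 1 by lia]
      exact ⟨q - 1, by rw [← Nat.sq_sub_sq q 1, one_pow]⟩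
  card_ne_one s hs hsa := hF ▸ prime_not_dvd_card_sub hq2 hr hodd hcop ha hs hsa
  card_pow_eq_one s hs hsa := hF ▸ card_pow_eq_one ha hsa
  pow_eq_one A hA hAa hirr hdeg B hB hBA := by
    have : NeZero r := ⟨hr.ne_zero⟩
    rw [← hn] at ha
    rcases Int.units_eq_one_or ε with rfl | rfl
    · rw [show a * n = Nat.card F ^ r - 1 by
        rw [hF, if_pos rfl]
        have : 1 ≤ q ^ r := Nat.one_le_pow _ _ (by lia)
        zify [this]
        simpa using ha]
      exact pow_card_pow_sub_one_eq_one_of_commute hirr hdeg hBA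
    · have han : a * n = (p ^ k) ^ r + 1 := by
        rw [← hq]
        zify
        simpa using ha
      rw [GLEps_neg_one] at hA hB
      rw [han]
      refine pow_add_one_eq_one_of_commute ?_ hodd hA ?_ hirr hdeg hB hBA
      · rw [hF, if_neg (by decide), hq]
      · rw [← han, pow_mul, hAa, one_pow]

end GLEps

end

/-! ### Linear independence of the powers of a lift of `σ` -/

section

open Polynomial Matrix

namespace HasTorusArithmetic

variable {F : Type*} [Field F] [Finite F] {r n a : ℕ} {U : Subgroup (GL (Fin r) F)}

/-- The powers of a lift of `σ` are linearly independent, because they induce distinct field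
automorphisms of the field generated by a lift of a power of `z`. -/
theorem linearIndependent_pow (h : HasTorusArithmetic U n a) (ha : 1 < a)
    {z σ : U.map (ProjGenLinGroup.mk (n := Fin r) (R := F))} (hza : orderOf z = a)
    (hzσ : IsSingerPair z σ r) {S : GL (Fin r) F} (hS : ProjGenLinGroup.mk S = σ.1) :
    LinearIndependent F fun i : Fin r => S.1 ^ (i : ℕ) := by
  have hr := hzσ.prime
  have : NeZero r := ⟨hr.ne_zero⟩
  obtain ⟨s, hs, hsa⟩ := Nat.exists_prime_and_dvd ha.ne'
  obtain ⟨l, hl⟩ := hsa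
  have hzl : orderOf (z ^ l) = s := by
    have hl0 : l ≠ 0 := by
      rintro rfl
      lia
    rw [orderOf_pow_of_dvd hl0 (by rw [hza, hl]; exact dvd_mul_left l s), hza, hl,
      Nat.mul_div_cancel _ (Nat.pos_of_ne_zero hl0)]
  have hsa : s ∣ a := ⟨l, hl⟩
  have hy1' : z ^ l ≠ 1 := by
    intro h1
    rw [h1, orderOf_one] at hzl
    exact hs.one_lt.ne hzl
  have hy1 : (z ^ l : U.map ProjGenLinGroup.mk).1 ≠ 1 := fun h1 => hy1' (Subtype.ext h1)
  have hys : (z ^ l : U.map ProjGenLinGroup.mk).1 ^ s = 1 := by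
    rw [← SubgroupClass.coe_pow, ← hzl, pow_orderOf_eq_one, OneMemClass.coe_one]
  obtain ⟨A, hA, hAy, hAs, hirr, hdeg⟩ := h.exists_lift hr hs hsa (z ^ l).2 hys hy1
  have : Fact (Irreducible (minpoly F A.1)) := ⟨hirr⟩
  have hx : ∀ i : ℕ, ∃ x, adjoinRootMinpolyHom A.1 x = (S ^ i * A * (S ^ i)⁻¹ : GL (Fin r) F).1 := by
    intro i
    suffices hc : Commute (S ^ i * A * (S ^ i)⁻¹) A from
      exists_adjoinRoot_eq_of_commute hdeg (hc.map (Units.coeHom _))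
    refine commute_of_commute_mk (h.coprime_card_sub_one hs hsa) hAs ?_
    rw [map_mul, map_mul, map_inv, hAy, map_pow, hS]
    obtain ⟨k, hk⟩ := hzσ.conj_mem_of_mem
      (pow_mem (Subgroup.mem_sup_right (Subgroup.mem_zpowers σ)) i) (Subgroup.npow_mem_zpowers z l)
    rw [← SubgroupClass.coe_pow]
    change Commute (σ ^ i * z ^ l * (σ ^ i)⁻¹).1 _
    rw [← hk]
    exact (((Commute.refl z).zpow_left k).pow_right l).map (Subgroup.subtype _)
  choose x hx using hx
  refine linearIndependent_of_mul_eq (A := A.1) (x := fun i : Fin r => x i) ?_ ?_ ?_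
  · intro i
    rw [← Units.val_pow_eq_pow_val]
    exact Units.ne_zero _
  · intro i j hij
    have h1 : S ^ (i : ℕ) * A * (S ^ (i : ℕ))⁻¹ = S ^ (j : ℕ) * A * (S ^ (j : ℕ))⁻¹ := by
      ext1
      rw [← hx, ← hx]
      exact congrArg _ hij
    have h2 : Commute ((S ^ (j : ℕ))⁻¹ * S ^ (i : ℕ)) A := by
      rw [mul_inv_eq_iff_eq_mul] at h1
      rw [commute_iff_eq, mul_assoc, h1]
      group
    have h3 : Commute ((σ ^ (j : ℕ))⁻¹ * σ ^ (i : ℕ)) (z ^ l) := by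
      have := h2.map ProjGenLinGroup.mk
      rw [map_mul, map_inv, map_pow, map_pow, hS, hAy] at this
      exact Subtype.ext this
    have h4 := hzσ.eq_one_of_mem
      (hzσ.mem_of_commute _ (Subgroup.npow_mem_zpowers z l) hy1' _ h3)
      (mul_mem (inv_mem (Subgroup.npow_mem_zpowers σ j)) (Subgroup.npow_mem_zpowers σ i))
    rw [inv_mul_eq_one, pow_inj_mod, hzσ.orderOf_right, Nat.mod_eq_of_lt i.2,
      Nat.mod_eq_of_lt j.2] at h4
    exact Fin.ext h4.symm
  · intro i
    rw [hx, ← Units.val_pow_eq_pow_val, ← Units.val_mul, ← Units.val_mul, inv_mul_cancel_right]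

/-- An element of `U` that is a linear combination of powers of a lift of `σ` with at least two
nonzero coefficients gives an element of `N_G(⟨σ⟩)` outside `⟨σ⟩`. -/
theorem exists_mem_normalizer (hr : 0 < r)
    {σ : U.map (ProjGenLinGroup.mk (n := Fin r) (R := F))} (hσ : orderOf σ = r)
    {S : GL (Fin r) F} (hS : ProjGenLinGroup.mk S = σ.1)
    (hlin : LinearIndependent F fun i : Fin r => S.1 ^ (i : ℕ)) {u : GL (Fin r) F} (hu : u ∈ U)
    (c : Fin r → F) (huc : u.1 = ∑ i, c i • S.1 ^ (i : ℕ)) {i j : Fin r} (hij : i ≠ j)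
    (hi : c i ≠ 0) (hj : c j ≠ 0) :
    ∃ g ∈ Subgroup.normalizer (Subgroup.zpowers σ : Set (U.map ProjGenLinGroup.mk)),
      g ∉ Subgroup.zpowers σ := by
  let g : U.map (ProjGenLinGroup.mk (n := Fin r) (R := F)) :=
    ⟨ProjGenLinGroup.mk u, u, hu, rfl⟩
  have hcomm : Commute u S := by
    ext1
    change Commute u.1 S.1
    rw [huc]
    exact Commute.sum_left _ _ _ fun i _ => ((Commute.refl S.1).pow_left _).smul_left _
  have hg : Commute g σ := Subtype.ext (by
    have := hcomm.map ProjGenLinGroup.mk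
    rwa [hS] at this)
  refine ⟨g, ?_, fun hgσ => ?_⟩
  · rw [mem_normalizer_zpowers_iff, hg.eq, mul_inv_cancel_right]
    exact Subgroup.mem_zpowers σ
  · rw [← mem_powers_iff_mem_zpowers] at hgσ
    obtain ⟨m, hm⟩ := hgσ
    dsimp only at hm
    rw [← pow_mod_orderOf, hσ] at hm
    have h1 : ProjGenLinGroup.mk (S ^ (m % r)) = ProjGenLinGroup.mk u := by
      rw [map_pow, hS]
      exact congrArg Subtype.val hm
    obtain ⟨d, hd⟩ := ProjGenLinGroup.mk_eq_mk_iff.1 h1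
    -- If the image of `u` were `σ ^ m`, then `u` would be a scalar multiple of the single power `S
    -- ^ k`, contradicting its two nonzero coefficients.
    let k : Fin r := ⟨m % r, Nat.mod_lt _ hr⟩
    have h2 : ∑ i, c i • S.1 ^ (i : ℕ) =
        ∑ i, (Pi.single k (d : F) : Fin r → F) i • S.1 ^ (i : ℕ) := by
      rw [← huc, ← hd, Finset.sum_eq_single k]
      · rw [Pi.single_eq_same, Units.val_mul, Units.val_pow_eq_pow_val,
          GeneralLinearGroup.coe_scalar, Matrix.scalar_apply, ← Matrix.smul_one_eq_diagonal,
          mul_smul_one]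
      · intro b _ hb
        rw [Pi.single_eq_of_ne hb, zero_smul]
      · simp
    have h3 := Fintype.linearIndependent_iff.1 hlin (c - Pi.single k (d : F)) (by
      simp only [Pi.sub_apply, sub_smul, Finset.sum_sub_distrib, h2, sub_self])
    have h4 : ∀ i, c i ≠ 0 → i = k := by
      intro i hi
      by_contra hik
      refine hi ?_
      simpa [Pi.single_eq_of_ne hik] using h3 i
    exact hij ((h4 i hi).trans (h4 j hj).symm)

end HasTorusArithmetic

end

section

open Polynomial Matrix

/-! ### Elements centralising `σ` -/

section GeomSum

variable {R F : Type*} [Ring R] [CommRing F] [Algebra F R] {S : R} {r : ℕ}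

lemma pow_mul_geom_sum_of_pow_eq_one (hS : S ^ r = 1) (m : ℕ) :
    S ^ m * ∑ i ∈ Finset.range r, S ^ i = ∑ i ∈ Finset.range r, S ^ i := by
  induction m with
  | zero => simp
  | succ m ih =>
    have h1 := mul_geom_sum S r
    rw [hS, sub_self, sub_mul, one_mul, sub_eq_zero] at h1
    rw [pow_succ, mul_assoc, h1, ih]

/-- The sum `J` of the powers of `S` satisfies `J ^ 2 = r • J`, so the product is `1 + (d + e + r *
d * e) • J`. -/
lemma one_add_smul_mul_one_add_smul (hS : S ^ r = 1) {d e : F} (h : d + e + r * d * e = 0) :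
    (1 + d • ∑ i ∈ Finset.range r, S ^ i) * (1 + e • ∑ i ∈ Finset.range r, S ^ i) = 1 := by
  have h1 : (∑ i ∈ Finset.range r, S ^ i) * (∑ i ∈ Finset.range r, S ^ i) =
      (r : F) • ∑ i ∈ Finset.range r, S ^ i := by
    nth_rewrite 1 [Finset.sum_mul]
    rw [Finset.sum_congr rfl fun i _ => pow_mul_geom_sum_of_pow_eq_one hS i, Finset.sum_const,
      Finset.card_range, Nat.cast_smul_eq_nsmul]
  rw [mul_add, add_mul, one_mul, mul_one, add_mul, one_mul, smul_mul_smul_comm, h1, smul_smul,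
    add_assoc, ← add_smul, ← add_smul]
  rw [show d + (e + d * e * r) = 0 by linear_combination h, zero_smul, add_zero]

/-- Inversion permutes the powers of `S`. In the unitary case `S'` is the conjugate transpose of
`S`. -/
lemma geom_sum_eq_of_mul_eq_one (hS : S ^ r = 1) {S' : R} (hS' : S' * S = 1) :
    ∑ i ∈ Finset.range r, S' ^ i = ∑ i ∈ Finset.range r, S ^ i := by
  have h2 : ∀ i, S' ^ i * S ^ i = 1 := by
    intro i
    induction i with
    | zero => simp
    | succ i ih => rw [pow_succ, pow_succ', mul_assoc, ← mul_assoc S', hS', one_mul, ih]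
  have h1 : ∀ i ∈ Finset.range r, S' ^ i = S ^ (r - 1 - i + 1) := by
    intro i hi
    have hi := Finset.mem_range.1 hi
    calc S' ^ i = S' ^ i * (S ^ i * S ^ (r - 1 - i + 1)) := by
          rw [← pow_add, show i + (r - 1 - i + 1) = r by lia, hS, mul_one]
      _ = S ^ (r - 1 - i + 1) := by rw [← mul_assoc, h2, one_mul]
  rw [Finset.sum_congr rfl h1, Finset.sum_range_reflect fun j => S ^ (j + 1)]
  simp only [pow_succ']
  rw [← Finset.mul_sum]
  simpa using pow_mul_geom_sum_of_pow_eq_one hS 1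

end GeomSum

section FiniteField

variable {F : Type*} [Field F] [Finite F]

lemma exists_add_add_mul_eq_zero (hF : 2 < Nat.card F) (t : F) :
    ∃ d e : F, d ≠ 0 ∧ d + e + t * d * e = 0 := by
  classical
  have := Fintype.ofFinite F
  -- Excluding `-t⁻¹` keeps `1 + t * d` invertible; then `e = -d / (1 + t * d)`.
  obtain ⟨d, hd⟩ : ∃ d : F, d ∉ ({0, -t⁻¹} : Finset F) := by
    by_contra! hcon
    have h1 := Finset.card_le_card (fun d _ => hcon d : (Finset.univ : Finset F) ⊆ {0, -t⁻¹})
    rw [Finset.card_univ, ← Nat.card_eq_fintype_card] at h1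
    exact absurd (h1.trans Finset.card_le_two) (by lia)
  simp only [Finset.mem_insert, Finset.mem_singleton, not_or] at hd
  have h1 : 1 + t * d ≠ 0 := by
    intro h1
    have ht : t ≠ 0 := by
      rintro rfl
      simp at h1
    refine hd.2 (mul_left_cancel₀ ht ?_)
    rw [mul_neg, mul_inv_cancel₀ ht]
    linear_combination h1
  refine ⟨d, -d / (1 + t * d), hd.1, ?_⟩
  linear_combination div_mul_cancel₀ (-d) h1

/-- For `t ≠ 0` in `F` the equation says that `1 + t * d` has norm 1 to the subfield of order `q`,
and the choice below makes it `x ^ q / x`. For `t = 0` it says that `d` has trace 0, as `x ^ q - x`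
does. -/
lemma exists_add_pow_add_mul_eq_zero {p k q : ℕ} [ExpChar F p] (hq : q = p ^ k) (hq2 : 2 ≤ q)
    (hF : Nat.card F = q ^ 2) (t : ℕ) :
    ∃ d : F, d ≠ 0 ∧ d + d ^ q + t * d * d ^ q = 0 := by
  have := Fintype.ofFinite F
  obtain ⟨x, hx⟩ : ∃ x : F, x ^ q ≠ x := by
    by_contra! hcon
    have h0 : (X ^ q - X : F[X]) ≠ 0 := FiniteField.X_pow_card_sub_X_ne_zero F hq2
    have h1 := card_le_degree_of_subset_roots (p := (X ^ q - X : F[X])) (Z := Finset.univ) (by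
      intro x _
      rw [mem_roots h0]
      simp [hcon x])
    rw [FiniteField.X_pow_card_sub_X_natDegree_eq F hq2, Finset.card_univ,
      ← Nat.card_eq_fintype_card, hF] at h1
    nlinarith
  have hx2 : (x ^ q) ^ q = x := by
    rw [← pow_mul, ← sq, ← hF, Nat.card_eq_fintype_card, FiniteField.pow_card]
  have hsub : ∀ u v : F, (u - v) ^ q = u ^ q - v ^ q := by
    intro u v
    rw [hq]
    exact sub_pow_expChar_pow ..
  by_cases ht : (t : F) = 0
  · refine ⟨x ^ q - x, sub_ne_zero.2 hx, ?_⟩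
    rw [hsub, hx2, ht]
    ring
  · have hx0 : x ≠ 0 := by
      rintro rfl
      exact hx (zero_pow (by lia))
    have htq : (t : F) ^ q = t := by
      rw [hq]
      exact map_natCast (iterateFrobenius F p k) t
    refine ⟨(x ^ q - x) / (t * x), div_ne_zero (sub_ne_zero.2 hx) (mul_ne_zero ht hx0), ?_⟩
    rw [div_pow, hsub, mul_pow, hx2, htq]
    have : x ^ q ≠ 0 := pow_ne_zero _ hx0
    field_simp
    ring

end FiniteField

section Units

variable {F : Type*} [Field F] {r : ℕ}

/-- A vector killed by `1 + S + S ^ 2` is fixed by `S ^ 3` and by `S ^ r`, hence by `S`; so it is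
killed by 3. -/
lemma isUnit_one_add_add_sq {S : Matrix (Fin r) (Fin r) F} (hS : S ^ r = 1) (h3 : (3 : F) ≠ 0)
    (hr : ¬ 3 ∣ r) : IsUnit (1 + S + S ^ 2) := by
  rw [Matrix.isUnit_iff_isUnit_det, isUnit_iff_ne_zero]
  intro hdet
  obtain ⟨v, hv, hSv⟩ := Matrix.exists_mulVec_eq_zero_iff.2 hdet
  refine hv ?_
  have h1 : (S ^ 3) *ᵥ v = v := by
    have h2 : ((S - 1) * (1 + S + S ^ 2)) *ᵥ v = 0 := by
      rw [← mulVec_mulVec, hSv, mulVec_zero]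
    rw [show (S - 1) * (1 + S + S ^ 2) = S ^ 3 - 1 by noncomm_ring, sub_mulVec, one_mulVec,
      sub_eq_zero] at h2
    exact h2
  have h2 : ∀ m : ℕ, (S ^ (3 * m)) *ᵥ v = v := by
    intro m
    induction m with
    | zero => simp
    | succ m ih => rw [Nat.mul_succ, pow_add, ← mulVec_mulVec, h1, ih]
  have h4 : S *ᵥ v = v := by
    have h5 : (S ^ (r % 3 + 3 * (r / 3))) *ᵥ v = v := by rw [Nat.mod_add_div, hS, one_mulVec]
    have h6 : r % 3 = 1 ∨ r % 3 = 2 := by lia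
    rw [pow_add, ← mulVec_mulVec, h2] at h5
    rcases h6 with h6 | h6
    · rwa [h6, pow_one] at h5
    · rw [h6] at h5
      rwa [pow_succ', ← mulVec_mulVec, h5] at h1
  rw [add_mulVec, add_mulVec, one_mulVec, sq, ← mulVec_mulVec, h4, h4] at hSv
  have h7 : (3 : F) • v = 0 := by
    rw [← hSv]
    module
  exact (smul_eq_zero.1 h7).resolve_left h3

end Units

namespace HasTorusArithmetic

variable {F : Type*} [Field F] [Finite F] {r : ℕ} {U : Subgroup (GL (Fin r) F)}

lemma exists_mem_normalizer_of_one_add_smul (hr : 3 ≤ r)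
    {σ : U.map (ProjGenLinGroup.mk (n := Fin r) (R := F))} (hσ : orderOf σ = r)
    {S : GL (Fin r) F} (hS : ProjGenLinGroup.mk S = σ.1)
    (hlin : LinearIndependent F fun i : Fin r => S.1 ^ (i : ℕ)) {u : GL (Fin r) F} (hu : u ∈ U)
    {d : F} (hd : d ≠ 0) (hud : u.1 = 1 + d • ∑ i ∈ Finset.range r, S.1 ^ i) :
    ∃ g ∈ Subgroup.normalizer (Subgroup.zpowers σ : Set (U.map ProjGenLinGroup.mk)),
      g ∉ Subgroup.zpowers σ := by
  have h0 : 0 < r := by lia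
  -- Positions 1 and 2 are used because the coefficient `1 + d` at position 0 may vanish.
  refine exists_mem_normalizer h0 hσ hS hlin hu
    (Pi.single ⟨0, h0⟩ 1 + fun _ => d) ?_ (i := ⟨1, by lia⟩) (j := ⟨2, by lia⟩) (by simp)
    (by simpa [Pi.single_apply] using hd) (by simpa [Pi.single_apply] using hd)
  rw [hud, Finset.sum_range, Finset.smul_sum]
  simp only [Pi.add_apply, add_smul, Finset.sum_add_distrib]
  congr 1
  rw [Finset.sum_eq_single ⟨0, h0⟩]
  · simp
  · intro b _ hb
    rw [Pi.single_eq_of_ne hb, zero_smul]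
  · simp

lemma exists_mem_normalizer_of_two (hr : 5 ≤ r) (h3r : ¬ 3 ∣ r) (h3 : (3 : F) ≠ 0) (hU : U = ⊤)
    {σ : U.map (ProjGenLinGroup.mk (n := Fin r) (R := F))} (hσ : orderOf σ = r)
    {S : GL (Fin r) F} (hS : ProjGenLinGroup.mk S = σ.1) (hSr : S ^ r = 1)
    (hlin : LinearIndependent F fun i : Fin r => S.1 ^ (i : ℕ)) :
    ∃ g ∈ Subgroup.normalizer (Subgroup.zpowers σ : Set (U.map ProjGenLinGroup.mk)),
      g ∉ Subgroup.zpowers σ := by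
  obtain ⟨u, hu⟩ := isUnit_one_add_add_sq (by simpa using congrArg Units.val hSr) h3 h3r
  have h0 : 0 < r := by lia
  have h1 : 1 < r := by lia
  have h2 : 2 < r := by lia
  refine exists_mem_normalizer h0 hσ hS hlin (u := u) (hU ▸ Subgroup.mem_top u)
    (Pi.single ⟨0, h0⟩ 1 + Pi.single ⟨1, h1⟩ 1 + Pi.single ⟨2, h2⟩ 1) ?_
    (i := ⟨1, h1⟩) (j := ⟨2, h2⟩) (by simp) (by simp)
    (by simp)
  rw [hu]
  simp [add_smul, Finset.sum_add_distrib, Pi.single_apply]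

theorem exists_mem_normalizer_generalUnitary {p k q : ℕ} [ExpChar F p] (hq : q = p ^ k)
    (hq2 : 2 ≤ q) (hF : Nat.card F = q ^ 2) (hr : 3 ≤ r) (hU : U = generalUnitary p k r F)
    {σ : U.map (ProjGenLinGroup.mk (n := Fin r) (R := F))} (hσ : orderOf σ = r)
    {S : GL (Fin r) F} (hSU : S ∈ U) (hS : ProjGenLinGroup.mk S = σ.1) (hSr : S ^ r = 1)
    (hlin : LinearIndependent F fun i : Fin r => S.1 ^ (i : ℕ)) :
    ∃ g ∈ Subgroup.normalizer (Subgroup.zpowers σ : Set (U.map ProjGenLinGroup.mk)),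
      g ∉ Subgroup.zpowers σ := by
  obtain ⟨d, hd, hd'⟩ := exists_add_pow_add_mul_eq_zero hq hq2 hF r
  have hSr' : S.1 ^ r = 1 := by simpa using congrArg Units.val hSr
  have h1 := one_add_smul_mul_one_add_smul hSr' hd'
  let u : GL (Fin r) F := ⟨_, _, h1, mul_eq_one_comm.1 h1⟩
  refine exists_mem_normalizer_of_one_add_smul hr hσ hS hlin (u := u) ?_ hd rfl
  rw [hU, mem_generalUnitary]
  rw [hU, mem_generalUnitary] at hSU
  have h2 : ∀ M : Matrix (Fin r) (Fin r) F,
      (M.map (iterateFrobenius F p k))ᵀ = ((iterateFrobenius F p k).mapMatrix M)ᵀ := fun _ => rfl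
  have h3 : (u.1.map (iterateFrobenius F p k))ᵀ =
      1 + d ^ q • ∑ i ∈ Finset.range r, S.1 ^ i := by
    rw [← geom_sum_eq_of_mul_eq_one hSr' (mul_eq_one_comm.1 hSU), h2]
    change ((iterateFrobenius F p k).mapMatrix (1 + d • ∑ i ∈ Finset.range r, S.1 ^ i))ᵀ = _
    rw [map_add, map_one, transpose_add, transpose_one]
    congr 1
    have h4 : ∀ M : Matrix (Fin r) (Fin r) F, (iterateFrobenius F p k).mapMatrix (d • M) =
        d ^ q • (iterateFrobenius F p k).mapMatrix M := by
      intro M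
      ext i j
      simp [iterateFrobenius_def, mul_pow, hq]
    rw [h4, transpose_smul, map_sum, transpose_sum]
    congr 1
    refine Finset.sum_congr rfl fun i _ => ?_
    rw [map_pow, transpose_pow, h2]
  rw [h3]
  exact h1

theorem exists_mem_normalizer_top (hF : 2 < Nat.card F) (hr : 3 ≤ r) (hU : U = ⊤)
    {σ : U.map (ProjGenLinGroup.mk (n := Fin r) (R := F))} (hσ : orderOf σ = r)
    {S : GL (Fin r) F} (hS : ProjGenLinGroup.mk S = σ.1) (hSr : S ^ r = 1)
    (hlin : LinearIndependent F fun i : Fin r => S.1 ^ (i : ℕ)) :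
    ∃ g ∈ Subgroup.normalizer (Subgroup.zpowers σ : Set (U.map ProjGenLinGroup.mk)),
      g ∉ Subgroup.zpowers σ := by
  obtain ⟨d, e, hd, hde⟩ := exists_add_add_mul_eq_zero hF (r : F)
  have hSr' : S.1 ^ r = 1 := by simpa using congrArg Units.val hSr
  have h1 := one_add_smul_mul_one_add_smul hSr' hde
  exact exists_mem_normalizer_of_one_add_smul hr hσ hS hlin
    (u := ⟨_, _, h1, mul_eq_one_comm.1 h1⟩) (hU ▸ Subgroup.mem_top _) hd rfl

end HasTorusArithmetic

open MulAction in
/-- In `PGL_3(2)` the element `σ` has exactly two fixed points on the cosets of `7:3`. -/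
theorem exists_mem_normalizer_three_two {F : Type*} [Field F] [Finite F] (hF : Nat.card F = 2)
    {U : Subgroup (GL (Fin 3) F)} (hU : U = ⊤)
    {z σ : U.map (ProjGenLinGroup.mk (n := Fin 3) (R := F))} (hz : orderOf z = 7)
    (h : IsSingerPair z σ 3) {Ω : Type*} [MulAction (U.map ProjGenLinGroup.mk) Ω]
    [IsPretransitive (U.map (ProjGenLinGroup.mk (n := Fin 3) (R := F))) Ω] {α : Ω}
    (hα : stabilizer (U.map ProjGenLinGroup.mk) α =
      Subgroup.zpowers z ⊔ Subgroup.zpowers σ) :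
    ∃ g ∈ Subgroup.normalizer (Subgroup.zpowers σ : Set (U.map ProjGenLinGroup.mk)),
      g ∉ Subgroup.zpowers σ := by
  by_contra! hcon
  have := finite_of_isPretransitive (U.map (ProjGenLinGroup.mk (n := Fin 3) (R := F))) α
  have hN : Subgroup.normalizer (Subgroup.zpowers σ : Set (U.map ProjGenLinGroup.mk)) =
      Subgroup.zpowers σ := le_antisymm hcon Subgroup.le_normalizer
  have hfix := h.ncard_fixedBy_mul hα
  rw [hN, Nat.card_zpowers, h.orderOf_right] at hfix
  have hcard : Nat.card (U.map (ProjGenLinGroup.mk (n := Fin 3) (R := F))) = 168 := by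
    rw [hU, ← MonoidHom.range_eq_map, MonoidHom.range_eq_top.2 ProjGenLinGroup.mk_surjective,
      Subgroup.card_top]
    -- Over two elements the only nonzero scalar is 1, so `PGL_3(2) = GL_3(2)` has order 168 and `Ω`
    -- has 168 / 21 = 8 points.
    have h1 : Function.Injective (ProjGenLinGroup.mk (n := Fin 3) (R := F)) := by
      rw [injective_iff_map_eq_one]
      intro A hA
      rw [ProjGenLinGroup.mk_eq_one, GeneralLinearGroup.center_eq_range_scalar] at hA
      obtain ⟨c, rfl⟩ := hA
      have : Nat.card Fˣ = 1 := by rw [Nat.card_units, hF]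
      have := (Nat.card_eq_one_iff_unique.1 this).1
      rw [Subsingleton.elim c 1, map_one]
    have := Fintype.ofFinite F
    rw [← Nat.card_eq_of_bijective _ ⟨h1, ProjGenLinGroup.mk_surjective⟩, Matrix.card_GL_field,
      ← Nat.card_eq_fintype_card, hF]
    simp [Fin.prod_univ_three]
  have hΩ : Nat.card Ω = 8 := by
    have h1 := (Subgroup.zpowers z ⊔ Subgroup.zpowers σ).index_mul_card
    rw [h.card_sup, hz, hcard, ← hα, index_stabilizer, orbit_eq_univ, Set.ncard_univ] at h1
    lia
  have : Fact (Nat.Prime 3) := ⟨h.prime⟩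
  -- The number of fixed points of `⟨σ⟩` is congruent to 8 modulo 3, so it cannot be 1.
  have hmod := (IsPGroup.of_card (p := 3) (n := 1) (G := Subgroup.zpowers σ)
    (by rw [Nat.card_zpowers, h.orderOf_right, pow_one])).card_modEq_card_fixedPoints Ω
  have hfp : fixedPoints (Subgroup.zpowers σ) Ω = fixedBy Ω σ := by
    ext β
    refine ⟨fun hβ => hβ ⟨σ, Subgroup.mem_zpowers σ⟩, fun hβ g => ?_⟩
    have : Subgroup.zpowers σ ≤ stabilizer _ β := Subgroup.zpowers_le.2 hβ
    exact this g.2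
  rw [hfp, Nat.card_coe_set_eq, hΩ] at hmod
  have : (fixedBy Ω σ).ncard = 1 := by lia
  rw [this] at hmod
  exact absurd hmod (by decide)

end

open MulAction in
/-- In `PGL_r^ε(q)` the group `⟨σ⟩` is properly contained in its normaliser. -/
theorem exists_mem_normalizer_GLEps {p k q r n a : ℕ} {ε : ℤˣ} {F : Type*} [Field F] [Finite F]
    [ExpChar F p] (hq : q = p ^ k) (hq2 : 2 ≤ q) (hr : r.Prime) (hodd : Odd r)
    (hF : Nat.card F = if ε = 1 then q else q ^ 2)
    (ha : (a : ℤ) * ((q : ℤ) - ε) = (q : ℤ) ^ r - ε) (ha1 : 1 < a) (hrn : r.Coprime n)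
    {U : Subgroup (GL (Fin r) F)} (hU : U = GLEps p k r F ε) (h : HasTorusArithmetic U n a)
    {P : Subgroup PGL(r, F)} (hP : P = U.map Matrix.ProjGenLinGroup.mk)
    {z σ : P} (hz : orderOf z = a) (hσ : orderOf σ = r)
    (hzσ : IsSingerPair z σ r) {Ω : Type*} [MulAction P Ω]
    [IsPretransitive P Ω] {α : Ω}
    (hα : stabilizer P α = Subgroup.zpowers z ⊔ Subgroup.zpowers σ) :
    ∃ g ∈ Subgroup.normalizer (Subgroup.zpowers σ : Set P),
      g ∉ Subgroup.zpowers σ := by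
  subst hP
  have hr3 : 3 ≤ r := by
    have := hr.two_le
    obtain ⟨m, rfl⟩ := hodd
    lia
  obtain ⟨S, hSU, hS, hSr⟩ := exists_lift_pow_eq_one h.scalar_pow hrn σ.2
    (congrArg Subtype.val (orderOf_dvd_iff_pow_eq_one.1 hσ.dvd))
  have hlin := h.linearIndependent_pow ha1 hz hzσ hS
  rcases Int.units_eq_one_or ε with rfl | rfl
  · rw [if_pos rfl] at hF
    rw [GLEps_one] at hU
    -- For `q = 2` the only candidate `1 + J`, with `J` the sum of the powers of `S`, squares to 0
    -- rather than being invertible, so `1 + S + S ^ 2` replaces it when `r ≥ 5`.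
    rcases eq_or_lt_of_le hq2 with h2 | h2
    · rw [← h2] at hF
      rcases eq_or_lt_of_le hr3 with rfl | hr3'
      · have ha7 : a = 7 := by
          rw [← h2] at ha
          norm_num at ha
          exact_mod_cast ha
        exact exists_mem_normalizer_three_two hF hU (hz.trans ha7) hzσ hα
      · have h3r : ¬ 3 ∣ r := fun h3 =>
          hr3'.ne ((Nat.prime_dvd_prime_iff_eq Nat.prime_three hr).1 h3)
        have hr5 : 5 ≤ r := by
          obtain ⟨m, rfl⟩ := hodd
          lia
        have h3 : (3 : F) ≠ 0 := by
          have := Fintype.ofFinite F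
          have h20 : (2 : F) = 0 := by
            have := FiniteField.cast_card_eq_zero F
            rw [← Nat.card_eq_fintype_card, hF] at this
            exact_mod_cast this
          rw [show (3 : F) = 2 + 1 by norm_num, h20, zero_add]
          exact one_ne_zero
        exact HasTorusArithmetic.exists_mem_normalizer_of_two hr5 h3r h3 hU hσ hS hSr
          hlin
    · exact HasTorusArithmetic.exists_mem_normalizer_top (hF ▸ h2) hr3 hU hσ hS hSr hlin
  · rw [if_neg (by decide)] at hF
    rw [GLEps_neg_one] at hU
    exact HasTorusArithmetic.exists_mem_normalizer_generalUnitary hq hq2 hF hr3 hU hσ hSU hS hSr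
      hlin

theorem mainTheorem7
    -- the prime power `q = p ^ k`, the odd prime `r`, the sign `ε`, the underlying field
    (p k q r : ℕ) [Fact p.Prime] (hk : 0 < k) (hq : q = p ^ k)
    (hr : r.Prime) (hr_odd : Odd r) (ε : ℤˣ)
    (F : Type*) [Field F] [CharP F p]
    (hF : Nat.card F = if ε = 1 then q else q ^ 2)
    -- `(q - ε, r) = 1` and `a = (q ^ r - ε) / (q - ε)`
    (hcop : Int.gcd ((q : ℤ) - ε) r = 1)
    (a : ℕ) (ha : (a : ℤ) * ((q : ℤ) - ε) = (q : ℤ) ^ r - ε)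
    -- `H = ⟨z⟩:⟨σ⟩ ≅ Z_a:Z_r` is a maximal subgroup of `G = PGL_r^ε(q)`
    (H : Subgroup (PGLEps p k r F ε)) (hmax : IsCoatom H)
    (z σ : PGLEps p k r F ε) (hz : orderOf z = a) (hσ : orderOf σ = r)
    (hnorm : σ * z * σ⁻¹ ∈ Subgroup.zpowers z)
    (hdisj : Subgroup.zpowers z ⊓ Subgroup.zpowers σ = ⊥)
    (hH : H = Subgroup.zpowers z ⊔ Subgroup.zpowers σ)
    -- `G` acts transitively on `Ω` with point stabiliser `G_α = H`
    (Ω : Type*) [MulAction (PGLEps p k r F ε) Ω]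
    [MulAction.IsPretransitive (PGLEps p k r F ε) Ω]
    (α : Ω) (hα : MulAction.stabilizer (PGLEps p k r F ε) α = H)
    -- `N = |N_G(⟨σ⟩)|`
    (N : ℕ) (hN : N = Nat.card
      (Subgroup.normalizer (Subgroup.zpowers σ : Set (PGLEps p k r F ε)))) :
    -- the subdegrees
    subdegrees (PGLEps p k r F ε) α ⊆ {1, Nat.card H, Nat.card H / r} ∧
    {1, Nat.card H / r} ⊆ subdegrees (PGLEps p k r F ε) α ∧
    (baseSize (PGLEps p k r F ε) Ω = 2 →
      subdegrees (PGLEps p k r F ε) α = {1, Nat.card H, Nat.card H / r}) ∧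
    -- their multiplicities
    subdegreeMultiplicity (PGLEps p k r F ε) α 1 = 1 ∧
    (subdegreeMultiplicity (PGLEps p k r F ε) α (Nat.card H) : ℚ) =
      (saxlValency (PGLEps p k r F ε) α : ℚ) / Nat.card H ∧
    (subdegreeMultiplicity (PGLEps p k r F ε) α (Nat.card H / r) : ℚ) = ((N : ℚ) - r) / r ∧
    -- the valency of the Saxl graph
    (saxlValency (PGLEps p k r F ε) α : ℚ) = (H.index : ℚ) + a - 1 - a * N / r := by
  have hq2 : 2 ≤ q := hq ▸ (Fact.out : p.Prime).two_le.trans (Nat.le_self_pow hk.ne' p)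
  have : Finite F := Nat.finite_of_card_ne_zero (by
    rw [hF]
    split_ifs <;> positivity)
  -- Here `n` is `q - ε` as a natural number; the scalars in `GL_r^ε(q)` have order dividing it.
  obtain ⟨n, hn⟩ := Int.eq_ofNat_of_zero_le (sub_units_pos hq2 ε).le
  have hT := hasTorusArithmetic_GLEps (F := F) hq hq2 hr hr_odd hF hcop ha hn.symm
  have ha1 : 1 < a := one_lt_of_mul_eq hq2 hr.one_lt ha
  have hrn : r.Coprime n := by
    rw [hn, Int.gcd_natCast_natCast] at hcop
    exact Nat.Coprime.symm hcop
  have hzσ : IsSingerPair z σ r :=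
    hT.isSingerPair hr ha1 (coprime_of_mul_eq hr hcop ha) hz hσ hnorm
  have hα' := hα.trans hH
  have hN' := exists_mem_normalizer_GLEps (P := PGLEps p k r F ε) hq hq2 hr hr_odd hF ha ha1 hrn rfl hT rfl hz hσ hzσ hα'
  have hcard : Nat.card H = orderOf z * r := hH ▸ hzσ.card_sup
  have hdiv : Nat.card H / r = orderOf z := by rw [hcard, Nat.mul_div_cancel _ hr.pos]
  obtain ⟨h1, h2, h3⟩ := hzσ.subdegree_structure hα' hN'
  obtain ⟨h4, h5, h6, h7⟩ := hzσ.multiplicity_structure hα' hN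
  rw [hdiv, hcard]
  rw [hα, hz] at h7
  exact ⟨h1, h2, h3, h4, h5, h6, h7⟩
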